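/- Let $0<J<h$. For $N\ge 1$ let $\mathcal H_N=-J\sum_{i=1}^N(S_i^xS_{i+1}^x+S_i^yS_{i+1}^y)-h\sum_{i=1}^N S_i^z$ be the Hamiltonian of the spin-$\tfrac12$ XX chain on a ring of $N$ sites ($S_{N+1}=S_1$, $\hbar=1$), and for $\beta>0$ let $$M_z(\beta)=\lim_{N\to\infty}\frac1N\,\frac{\operatorname{tr}\big(\sum_i S_i^z\,e^{-\beta\mathcal H_N}\big)}{\operatorname{tr}\big(e^{-\beta\mathcal H_N}\big)}$$ be the magnetization per site of the infinite chain at inverse temperature $\beta$. Let $\mathrm{Li}_s(x)=\sum_{k\ge1}x^k/k^s$ for $|x|<1$, and $(-1)!!=1$. Then the limit $M_z(\beta)$ exists for every $\beta>0$, and, as $\beta\to\infty$, $$M_z(\beta)\sim\frac12+\sum_{n=0}^\infty a_n(\beta),\qquad a_n(\beta)=\frac{[(2n-1)!!]^2}{n!\,8^n\sqrt{2\pi(\beta J)^{2n+1}}}\,\mathrm{Li}_{n+\frac12}\big(-e^{-\beta(h-J)}\big),$$ in the sense of asymptotic expansions: $a_{n+1}=o(a_n)$ for every $n\ge0$, and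 $M_z-\tfrac12-\sum_{n=0}^{m}a_n=o(a_m)$ for every $m\ge0$. Equivalently, in terms of the temperature $T=1/(k_B\beta)$ with any $k_B>0$, as $T\to0^+$ and in the same sense, $$M_z\sim\frac12-\sum_{n=0}^\infty \mathcal Q_{\frac{2n+1}{2}}(T)\,T^{\frac{2n+1}{2}},\qquad \mathcal Q_{\frac{2n+1}{2}}(T)=-\frac{\sqrt{k_B^{2n+1}}\,[(2n-1)!!]^2}{n!\,8^n\sqrt{2\pi J^{2n+1}}}\,\mathrm{Li}_{\frac{2n+1}{2}}\big(-e^{-(h-J)/(k_BT)}\big).$$ -/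

import Mathlib

open Filter Topology Asymptotics

noncomputable section

namespace SpinChain

/-! ### Finite spin-1/2 chains and their Gibbs states -/

/-- The spin-1/2 matrices `S^x`, `S^y`, `S^z` (with `ħ = 1`); the basis vector `0` is spin up and
the basis vector `1` is spin down. -/
def spinX : Matrix (Fin 2) (Fin 2) ℂ := !![0, 1 / 2; 1 / 2, 0]

/-- See `spinX`. -/
def spinY : Matrix (Fin 2) (Fin 2) ℂ := !![0, -Complex.I / 2; Complex.I / 2, 0]

/-- See `spinX`. -/
def spinZ : Matrix (Fin 2) (Fin 2) ℂ := !![1 / 2, 0; 0, -1 / 2]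

/-- Operators on the Hilbert space `(ℂ²)^{⊗ N}` of `N` spins, as matrices in the product basis,
which is indexed by the configurations `Fin N → Fin 2`. -/
abbrev ChainOp (N : ℕ) : Type := Matrix (Fin N → Fin 2) (Fin N → Fin 2) ℂ

/-- The one-site operator `1 ⊗ ⋯ ⊗ A ⊗ ⋯ ⊗ 1`, with `A` acting on the spin at site `i`. -/
def siteOp {N : ℕ} (i : Fin N) (A : Matrix (Fin 2) (Fin 2) ℂ) : ChainOp N :=
  Matrix.of fun σ τ => if ∀ j, j ≠ i → σ j = τ j then A (σ i) (τ i) else 0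

/-- The Heisenberg XY Hamiltonian
`-J ∑ᵢ ((1 + γ) Sˣᵢ Sˣᵢ₊₁ + (1 - γ) Sʸᵢ Sʸᵢ₊₁) - h ∑ᵢ Sᶻᵢ`
on a ring of `N` sites; `finRotate N` is the cyclic successor `i ↦ i + 1`. -/
def hamiltonianXY (N : ℕ) (J γ h : ℝ) : ChainOp N :=
  (-(J : ℂ)) • ∑ i : Fin N,
      (((1 + γ : ℝ) : ℂ) • (siteOp i spinX * siteOp (finRotate N i) spinX)
        + ((1 - γ : ℝ) : ℂ) • (siteOp i spinY * siteOp (finRotate N i) spinY))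
    - (h : ℂ) • ∑ i : Fin N, siteOp i spinZ

/-- The total spin `S_z = ∑ᵢ Sᶻᵢ`. -/
def totalSpinZ (N : ℕ) : ChainOp N := ∑ i : Fin N, siteOp i spinZ

/-- The thermal average `⟨A⟩ = tr (A e^{-βH}) / tr e^{-βH}` in the Gibbs state of `H` at inverse
temperature `β`. -/
def gibbsAverage {N : ℕ} (H : ChainOp N) (β : ℝ) (A : ChainOp N) : ℂ :=
  (A * NormedSpace.exp ((-(β : ℂ)) • H)).trace / (NormedSpace.exp ((-(β : ℂ)) • H)).trace

/-- The magnetization per site `⟨S_z⟩ / N` of the XX chain (`γ = 0`) on a ring of `N` sites.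
(The thermal average of a Hermitian operator is real.) -/
def finiteMagnetization (J h β : ℝ) (N : ℕ) : ℝ :=
  (gibbsAverage (hamiltonianXY N J 0 h) β (totalSpinZ N)).re / N

/-- The magnetization per site `M_z` of the infinite XX chain: the limit of `⟨S_z⟩ / N`
as `N → ∞`. -/
def magnetization (J h β : ℝ) : ℝ := limUnder atTop (finiteMagnetization J h β)

/-! ### The terms of the expansion -/

/-- The polylogarithm `Li_s(x) = ∑_{k ≥ 1} x^k / k^s`, for `|x| < 1`. -/
def polylog (s x : ℝ) : ℝ := ∑' k : ℕ, x ^ (k + 1) / ((k : ℝ) + 1) ^ s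

/-- The `n`-th term of the low-temperature expansion in the inverse temperature,
`[(2n-1)!!]² / (n! 8ⁿ √(2π (βJ)^{2n+1})) · Li_{n+1/2}(-e^{-β(h-J)})`; for `n = 0` the truncated
subtraction gives `0!! = 1`, the usual value of `(-1)!!`. -/
def expansionTerm (J h : ℝ) (n : ℕ) (β : ℝ) : ℝ :=
  ((2 * n - 1).doubleFactorial : ℝ) ^ 2
      / ((n.factorial : ℝ) * 8 ^ n * √(2 * Real.pi * (β * J) ^ (2 * n + 1)))
    * polylog ((n : ℝ) + 1 / 2) (-Real.exp (-(β * (h - J))))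

/-- The temperature-dependent coefficient of `T^{(2n+1)/2}`,
`Q_{(2n+1)/2}(T) = -√(k_B^{2n+1}) [(2n-1)!!]² / (n! 8ⁿ √(2π J^{2n+1})) · Li_{(2n+1)/2}(-e^{-(h-J)/(k_B T)})`. -/
def temperatureCoeff (kB J h : ℝ) (n : ℕ) (T : ℝ) : ℝ :=
  -(√(kB ^ (2 * n + 1)) * ((2 * n - 1).doubleFactorial : ℝ) ^ 2
      / ((n.factorial : ℝ) * 8 ^ n * √(2 * Real.pi * J ^ (2 * n + 1)))
    * polylog ((2 * (n : ℝ) + 1) / 2) (-Real.exp (-((h - J) / (kB * T)))))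

/-- `f ∼ a₀ + a₁ + a₂ + ⋯` along the filter `l`, in the sense of asymptotic expansions: the terms
are an asymptotic scale (each is negligible against the one before), and every partial sum
approximates `f` up to an error that is negligible against its last term. -/
def HasAsymptoticExpansion (l : Filter ℝ) (f : ℝ → ℝ) (a : ℕ → ℝ → ℝ) : Prop :=
  (∀ n, a (n + 1) =o[l] a n) ∧
    ∀ N, (fun x => f x - ∑ n ∈ Finset.range (N + 1), a n x) =o[l] a N

end SpinChain

end

/-!
The Jordan-Wigner transformation turns the spin flips into fermions `cᵢ`, `dᵢ` satisfying the
canonical anticommutation relations (`isCAR_jordanWigner`).  Up to the bond that closes the ring,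
the XX Hamiltonian is a hopping Hamiltonian for them; on that bond the strings of signs add up to
the parity operator.  Hence in each of the two parity sectors the chain is a ring of free fermions
with antiperiodic or periodic boundary conditions (`sector_mul_hamiltonianXY`), diagonalized by
plane waves of momentum `φₖ` with energies `h - J cos φₖ` (`twistedHop_eq_sum_mode`).

Traces against exponentials of free-fermion operators follow from the anticommutation relations
and the cyclicity of the trace alone (`IsCAR.trace_exp_sum`, `IsCAR.trace_number_mul_exp_sum`).
Inserting the parity operator only shifts all energies by a multiple of `π i`, which replaces the
Boltzmann factors `xₖ` by `-xₖ`; so the magnetization of the finite ring is an explicit weighted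
average (`finiteMagnetization_eq`).  Since `h > J`, the products `∏ (1 - xₖ)` are exponentially
small compared with `∏ (1 + xₖ)`, and the averages over the modes are Riemann sums, so that
`M_z = 1 / 2 - (2 / π) ∫ x / (1 + x) dθ` with `x = e^{-β (h - J)} e^{-2 β J sin² θ}` and `θ` in
`[0, π / 2]` (`tendsto_finiteMagnetization`, `downDensity_eq`).

A geometric series for `x / (1 + x)` gives `M_z - 1 / 2 = ∑ₗ (-e^{-β (h - J)})ˡ F(l β J)` over
`l ≥ 1`, where `F(y) = (2 / π) ∫ e^{-2 y sin² θ} dθ`.  Expanding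
`1 = cos θ (1 - sin² θ)^{-1/2}` in powers of `sin θ` yields the asymptotic expansion of `F` in
powers `y^{-n-1/2}` with a remainder bound valid for all `y > 0`
(`exists_abs_scaledBessel_sub_le`).  The bound may therefore be summed over `l`, which produces the
polylogarithms; both the `n`-th term and the error before it are of the exact order
`β^{-n-1/2} e^{-β (h - J)}`, because the summand `l = 1` dominates.
-/

noncomputable section

namespace SpinChain

open NormedSpace (exp)

/-! ### Traces of exponentials of free-fermion Hamiltonians -/

section ExpIdempotent

open scoped Matrix.Norms.Operator

theorem exp_smul_of_isIdempotentElem {m : Type*} [Fintype m] [DecidableEq m]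
    {n : Matrix m m ℂ} (hn : n * n = n) (t : ℂ) :
    exp (t • n) = 1 + (Complex.exp t - 1) • n := by
  have hpow : ∀ k : ℕ, n ^ (k + 1) = n := by
    intro k
    induction k with
    | zero => simp
    | succ k ih => rw [pow_succ, ih, hn]
  have h1 := NormedSpace.exp_series_hasSum_exp' (𝕂 := ℂ) (t • n)
  have h2 : HasSum (fun k : ℕ => ((k.factorial : ℂ)⁻¹ • t ^ k) • n + if k = 0 then 1 - n else 0)
      (exp t • n + (1 - n)) := by
    refine HasSum.add ((NormedSpace.exp_series_hasSum_exp' (𝕂 := ℂ) t).smul_const n) ?_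
    exact hasSum_ite_eq 0 (1 - n)
  have h3 : (fun k : ℕ => (k.factorial : ℂ)⁻¹ • (t • n) ^ k)
      = fun k : ℕ => ((k.factorial : ℂ)⁻¹ • t ^ k) • n + if k = 0 then 1 - n else 0 := by
    -- all powers of `n` of positive exponent are `n`; the term `k = 0` needs the correction `1 - n`
    funext k
    rcases k with _ | k
    · simp
    · rw [smul_pow, hpow, smul_assoc]; simp
  rw [h3] at h1
  refine (h1.unique h2).trans ?_
  rw [Complex.exp_eq_exp_ℂ, sub_smul, one_smul]
  abel

end ExpIdempotent

/-- The canonical anticommutation relations: `c i` are annihilation operators and `d i` are the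
corresponding creation operators.  No adjoint relation between `c i` and `d i` is required. -/
structure IsCAR {m ι : Type*} [Fintype m] [DecidableEq m] [DecidableEq ι]
    (c d : ι → Matrix m m ℂ) : Prop where
  cc : ∀ i j, c i * c j = -(c j * c i)
  dd : ∀ i j, d i * d j = -(d j * d i)
  cd : ∀ i j, c i * d j = (if i = j then 1 else 0) - d j * c i

namespace IsCAR

variable {m ι : Type*} [Fintype m] [DecidableEq m] [DecidableEq ι] {c d : ι → Matrix m m ℂ}

theorem c_mul_self (H : IsCAR c d) (i : ι) : c i * c i = 0 := by
  have h : (2 : ℂ) • (c i * c i) = 0 := by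
    rw [two_smul]
    nth_rewrite 1 [H.cc i i]
    exact neg_add_cancel _
  exact (smul_eq_zero.mp h).resolve_left two_ne_zero

theorem number_idempotent (H : IsCAR c d) (i : ι) : (d i * c i) * (d i * c i) = d i * c i := by
  have h : (d i * c i) * (d i * c i) = d i * (c i * d i) * c i := by noncomm_ring
  rw [h, H.cd, if_pos rfl, mul_sub, sub_mul, mul_one]
  have h' : d i * (d i * c i) * c i = d i * d i * (c i * c i) := by noncomm_ring
  rw [h', H.c_mul_self, mul_zero, sub_zero]

theorem commute_number_c (H : IsCAR c d) {i j : ι} (hij : i ≠ j) : Commute (d i * c i) (c j) := by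
  have h1 := H.cd j i
  rw [if_neg hij.symm, zero_sub] at h1
  rw [Commute, SemiconjBy, mul_assoc, H.cc i j, ← mul_assoc (c j), h1]
  noncomm_ring

theorem commute_number_d (H : IsCAR c d) {i j : ι} (hij : i ≠ j) : Commute (d i * c i) (d j) := by
  have h1 := H.cd i j
  rw [if_neg hij, zero_sub] at h1
  rw [Commute, SemiconjBy, mul_assoc, h1, ← mul_assoc (d j), H.dd j i]
  noncomm_ring

theorem commute_number (H : IsCAR c d) (i j : ι) : Commute (d i * c i) (d j * c j) := by
  rcases eq_or_ne i j with rfl | hij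
  · exact Commute.refl _
  · exact (H.commute_number_d hij).mul_right (H.commute_number_c hij)

/-- In the trace, an occupation number averages to `1 / 2` against every operator that commutes
with the annihilation operator of its mode: by cyclicity `tr (d c X) = tr (c d X)`. -/
theorem two_mul_trace_number_mul (H : IsCAR c d) (i : ι) {X : Matrix m m ℂ}
    (hX : Commute (c i) X) : 2 * (d i * c i * X).trace = X.trace := by
  have h : (d i * c i * X).trace = (c i * d i * X).trace := by
    rw [mul_assoc, hX.eq, ← mul_assoc, Matrix.trace_mul_comm, mul_assoc]
  rw [H.cd, if_pos rfl, sub_mul, one_mul, Matrix.trace_sub] at h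
  linear_combination h

/-- Splitting one mode off the exponential of a sum of commuting occupation numbers. -/
theorem exp_sum_insert (H : IsCAR c d) (t : ι → ℂ) {s : Finset ι} {a : ι} (ha : a ∉ s) :
    exp (∑ i ∈ insert a s, t i • (d i * c i))
      = (1 + (Complex.exp (t a) - 1) • (d a * c a)) * exp (∑ i ∈ s, t i • (d i * c i)) := by
  rw [Finset.sum_insert ha, Matrix.exp_add_of_commute,
    exp_smul_of_isIdempotentElem (H.number_idempotent a)]
  exact Commute.sum_right _ _ _ fun i _ =>
    ((H.commute_number a i).smul_left _).smul_right _

theorem commute_c_exp_sum (H : IsCAR c d) (t : ι → ℂ) {s : Finset ι} {a : ι} (ha : a ∉ s) :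
    Commute (c a) (exp (∑ i ∈ s, t i • (d i * c i))) :=
  Commute.exp_right <| Commute.sum_right _ _ _ fun _ hi =>
    ((H.commute_number_c (ne_of_mem_of_not_mem hi ha)).symm).smul_right _

theorem trace_exp_sum_insert (H : IsCAR c d) (t : ι → ℂ) {s : Finset ι} {a : ι} (ha : a ∉ s) :
    (exp (∑ i ∈ insert a s, t i • (d i * c i))).trace
      = (1 + Complex.exp (t a)) / 2 * (exp (∑ i ∈ s, t i • (d i * c i))).trace := by
  have h := H.two_mul_trace_number_mul a (H.commute_c_exp_sum t ha)
  rw [H.exp_sum_insert t ha, add_mul, one_mul, Matrix.trace_add, smul_mul_assoc,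
    Matrix.trace_smul, smul_eq_mul]
  linear_combination (Complex.exp (t a) - 1) / 2 * h

/-- The partition function of independent fermionic modes. -/
theorem trace_exp_sum (H : IsCAR c d) (t : ι → ℂ) (s : Finset ι) :
    (exp (∑ i ∈ s, t i • (d i * c i))).trace
      = Fintype.card m * ∏ i ∈ s, (1 + Complex.exp (t i)) / 2 := by
  induction s using Finset.induction_on with
  | empty => simp [NormedSpace.exp_zero]
  | insert a s ha ih => rw [H.trace_exp_sum_insert t ha, ih, Finset.prod_insert ha]; ring

/-- The mean occupation number of a mode, in a form free of division. -/
theorem trace_number_mul_exp_sum (H : IsCAR c d) (t : ι → ℂ) {s : Finset ι} {a : ι} (ha : a ∈ s) :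
    (1 + Complex.exp (t a)) * (d a * c a * exp (∑ i ∈ s, t i • (d i * c i))).trace
      = Complex.exp (t a) * (exp (∑ i ∈ s, t i • (d i * c i))).trace := by
  obtain ⟨r, har, rfl⟩ : ∃ r, a ∉ r ∧ insert a r = s :=
    ⟨s.erase a, Finset.notMem_erase a s, Finset.insert_erase ha⟩
  have h := H.two_mul_trace_number_mul a (H.commute_c_exp_sum t har)
  have hn : d a * c a * (1 + (Complex.exp (t a) - 1) • (d a * c a))
      = Complex.exp (t a) • (d a * c a) := by
    rw [mul_add, mul_one, mul_smul_comm, H.number_idempotent, sub_smul, one_smul]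
    abel
  rw [H.trace_exp_sum_insert t har, H.exp_sum_insert t har, ← mul_assoc, hn, smul_mul_assoc,
    Matrix.trace_smul, smul_eq_mul]
  linear_combination (1 + Complex.exp (t a)) * Complex.exp (t a) / 2 * h

/-- A change of modes preserves the anticommutation relations if the matrix `W` for the
annihilation operators is a left inverse of the matrix `V` for the creation operators. -/
theorem changeModes {κ : Type*} [DecidableEq κ] [Fintype ι] (H : IsCAR c d)
    {V : ι → κ → ℂ} {W : κ → ι → ℂ}
    (hWV : ∀ k l, ∑ i, W k i * V i l = if k = l then 1 else 0) :
    IsCAR (fun k => ∑ i, W k i • c i) (fun k => ∑ i, V i k • d i) where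
  cc k l := by
    simp only [Finset.sum_mul_sum, ← Finset.sum_neg_distrib]
    rw [Finset.sum_comm]
    refine Finset.sum_congr rfl fun i _ => Finset.sum_congr rfl fun j _ => ?_
    rw [smul_mul_smul_comm, smul_mul_smul_comm, H.cc, smul_neg, mul_comm]
  dd k l := by
    simp only [Finset.sum_mul_sum, ← Finset.sum_neg_distrib]
    rw [Finset.sum_comm]
    refine Finset.sum_congr rfl fun i _ => Finset.sum_congr rfl fun j _ => ?_
    rw [smul_mul_smul_comm, smul_mul_smul_comm, H.dd, smul_neg, mul_comm]
  cd k l := by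
    have h1 : (∑ i, W k i • c i) * (∑ j, V j l • d j)
        = (∑ i, W k i * V i l) • (1 : Matrix m m ℂ)
          - ∑ i, ∑ j, (W k i * V j l) • (d j * c i) := by
      rw [Finset.sum_mul_sum, Finset.sum_smul, ← Finset.sum_sub_distrib]
      refine Finset.sum_congr rfl fun i _ => ?_
      rw [Finset.sum_congr rfl fun j _ => by rw [smul_mul_smul_comm, H.cd, smul_sub],
        Finset.sum_sub_distrib]
      simp
    have h2 : (∑ j, V j l • d j) * (∑ i, W k i • c i)
        = ∑ i, ∑ j, (W k i * V j l) • (d j * c i) := by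
      rw [Finset.sum_mul_sum, Finset.sum_comm]
      refine Finset.sum_congr rfl fun i _ => Finset.sum_congr rfl fun j _ => ?_
      rw [smul_mul_smul_comm, mul_comm]
    rw [h1, h2, hWV]
    split_ifs <;> simp

end IsCAR

/-! ### One-site operators and strings of signs -/

section SiteOp

variable {N : ℕ}

theorem siteOp_apply (i : Fin N) (A : Matrix (Fin 2) (Fin 2) ℂ) (σ τ : Fin N → Fin 2) :
    siteOp i A σ τ = if ∀ j, j ≠ i → σ j = τ j then A (σ i) (τ i) else 0 := rfl

theorem siteOp_mul_apply (i : Fin N) (A : Matrix (Fin 2) (Fin 2) ℂ) (M : ChainOp N)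
    (σ τ : Fin N → Fin 2) :
    (siteOp i A * M) σ τ = ∑ a, A (σ i) a * M (Function.update σ i a) τ := by
  rw [Matrix.mul_apply]
  symm
  refine Finset.sum_of_injOn (fun a => Function.update σ i a) ?_
    (fun _ _ => Finset.mem_coe.2 (Finset.mem_univ _)) ?_ ?_
  · exact (Function.update_injective σ i).injOn
  · intro ρ _ hρ
    rw [siteOp_apply, if_neg, zero_mul]
    intro h
    refine hρ ⟨ρ i, by simp, ?_⟩
    funext j
    rcases eq_or_ne j i with rfl | hj
    · simp
    · simp [hj, h j hj]
  · intro a _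
    rw [siteOp_apply, if_pos]
    · simp
    · intro j hj
      simp [hj]

theorem siteOp_mul_siteOp_self (i : Fin N) (A B : Matrix (Fin 2) (Fin 2) ℂ) :
    siteOp i A * siteOp i B = siteOp i (A * B) := by
  ext σ τ
  have h : ∀ a, (∀ j, j ≠ i → Function.update σ i a j = τ j) ↔ ∀ j, j ≠ i → σ j = τ j :=
    fun a => forall₂_congr fun j hj => by simp [hj]
  simp only [siteOp_mul_apply, siteOp_apply, h, Function.update_self]
  split_ifs
  · rw [Matrix.mul_apply]
  · simp

theorem commute_siteOp {i j : Fin N} (hij : i ≠ j) (A B : Matrix (Fin 2) (Fin 2) ℂ) :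
    Commute (siteOp i A) (siteOp j B) := by
  rw [Commute, SemiconjBy, ← mul_one (siteOp i A * siteOp j B),
    ← mul_one (siteOp j B * siteOp i A), mul_assoc, mul_assoc]
  ext σ τ
  simp only [siteOp_mul_apply, Finset.mul_sum]
  rw [Finset.sum_comm]
  refine Finset.sum_congr rfl fun b _ => Finset.sum_congr rfl fun a _ => ?_
  rw [Function.update_of_ne hij.symm, Function.update_of_ne hij, Function.update_comm hij]
  ring

theorem siteOp_add (i : Fin N) (A B : Matrix (Fin 2) (Fin 2) ℂ) :
    siteOp i (A + B) = siteOp i A + siteOp i B := by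
  ext σ τ
  simp only [siteOp_apply, Matrix.add_apply]
  split_ifs <;> simp

theorem siteOp_smul (i : Fin N) (z : ℂ) (A : Matrix (Fin 2) (Fin 2) ℂ) :
    siteOp i (z • A) = z • siteOp i A := by
  ext σ τ
  simp only [siteOp_apply, Matrix.smul_apply]
  split_ifs <;> simp

theorem siteOp_neg (i : Fin N) (A : Matrix (Fin 2) (Fin 2) ℂ) :
    siteOp i (-A) = -siteOp i A := by
  rw [← neg_one_smul ℂ A, siteOp_smul, neg_one_smul]

theorem siteOp_diagonal (i : Fin N) (v : Fin 2 → ℂ) :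
    siteOp i (Matrix.diagonal v) = Matrix.diagonal fun σ => v (σ i) := by
  ext σ τ
  rw [siteOp_apply, Matrix.diagonal_apply, Matrix.diagonal_apply]
  by_cases h : σ = τ
  · subst h; simp
  · rw [if_neg h]
    split_ifs with h1 h2
    · refine absurd (funext fun j => ?_) h
      rcases eq_or_ne j i with rfl | hj
      · exact h2
      · exact h1 j hj
    · rfl
    · rfl

theorem siteOp_one (i : Fin N) : siteOp i (1 : Matrix (Fin 2) (Fin 2) ℂ) = 1 := by
  rw [← Matrix.diagonal_one, siteOp_diagonal, Matrix.diagonal_one]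

theorem siteOp_zero (i : Fin N) : siteOp i (0 : Matrix (Fin 2) (Fin 2) ℂ) = 0 := by
  rw [← zero_smul ℂ (0 : Matrix (Fin 2) (Fin 2) ℂ), siteOp_smul, zero_smul]

/-- The eigenvalue of the Pauli matrix `2 S^z` on a basis vector. -/
def spinSign (a : Fin 2) : ℂ := if a = 0 then 1 else -1

theorem spinSign_mul_self (a : Fin 2) : spinSign a * spinSign a = 1 := by
  unfold spinSign; split_ifs <;> simp

theorem spinSign_of_ne {a b : Fin 2} (h : a ≠ b) : spinSign a = -spinSign b := by
  fin_cases a <;> fin_cases b <;> simp_all [spinSign]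

/-- The product of the Pauli matrices `2 S^z` over the sites in `s`. -/
def signString (s : Finset (Fin N)) : ChainOp N :=
  Matrix.diagonal fun σ => ∏ l ∈ s, spinSign (σ l)

theorem signString_empty : signString (∅ : Finset (Fin N)) = 1 := by
  simp [signString]

theorem signString_insert {i : Fin N} {s : Finset (Fin N)} (hi : i ∉ s) :
    signString (insert i s) = siteOp i (Matrix.diagonal spinSign) * signString s := by
  rw [siteOp_diagonal, signString, signString, Matrix.diagonal_mul_diagonal]
  simp only [Finset.prod_insert hi]

theorem signString_mul_self (s : Finset (Fin N)) : signString s * signString s = 1 := by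
  rw [signString, Matrix.diagonal_mul_diagonal]
  simp only [← Finset.prod_mul_distrib, spinSign_mul_self, Finset.prod_const_one,
    Matrix.diagonal_one]

theorem commute_signString (s t : Finset (Fin N)) : Commute (signString s) (signString t) := by
  rw [Commute, SemiconjBy, signString, signString, Matrix.diagonal_mul_diagonal,
    Matrix.diagonal_mul_diagonal]
  simp only [mul_comm]

theorem commute_signString_siteOp {i : Fin N} {s : Finset (Fin N)} (hi : i ∉ s)
    (A : Matrix (Fin 2) (Fin 2) ℂ) : Commute (signString s) (siteOp i A) := by
  ext σ τ
  rw [signString, Matrix.diagonal_mul, Matrix.mul_diagonal, siteOp_apply]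
  split_ifs with h
  · rw [mul_comm, Finset.prod_congr rfl fun l hl => by rw [h l (ne_of_mem_of_not_mem hl hi)]]
  · simp

/-- A string of signs through the site `i` anticommutes with the spin flips at `i`. -/
theorem signString_mul_siteOp {i : Fin N} {s : Finset (Fin N)} (hi : i ∈ s)
    {A : Matrix (Fin 2) (Fin 2) ℂ} (hA : ∀ a, A a a = 0) :
    signString s * siteOp i A = -(siteOp i A * signString s) := by
  ext σ τ
  rw [signString, Matrix.neg_apply, Matrix.diagonal_mul, Matrix.mul_diagonal, siteOp_apply]
  split_ifs with h
  · by_cases h' : σ i = τ i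
    · simp [h', hA]
    · rw [← Finset.mul_prod_erase s _ hi, ← Finset.mul_prod_erase s _ hi, spinSign_of_ne h',
        Finset.prod_congr rfl fun l hl => by rw [h l (Finset.ne_of_mem_erase hl)]]
      ring
  · simp

end SiteOp

/-! ### The Jordan-Wigner transformation -/

section JordanWigner

variable {N : ℕ}

/-- The matrix raising a down spin, `S^+ = S^x + i S^y`. -/
def spinRaise : Matrix (Fin 2) (Fin 2) ℂ := !![0, 1; 0, 0]

/-- The matrix lowering an up spin, `S^- = S^x - i S^y`. -/
def spinLower : Matrix (Fin 2) (Fin 2) ℂ := !![0, 0; 1, 0]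

/-- The Jordan-Wigner dressing of `A` at the site `i`: `A` at `i` times the string of signs of all
sites before `i`. -/
def jordanWigner (i : Fin N) (A : Matrix (Fin 2) (Fin 2) ℂ) : ChainOp N :=
  signString (Finset.Iio i) * siteOp i A

/-- The string of the later site `j` passes through `i`, which is where the sign comes from. -/
theorem jordanWigner_mul_of_lt {i j : Fin N} (hij : i < j) {A : Matrix (Fin 2) (Fin 2) ℂ}
    (B : Matrix (Fin 2) (Fin 2) ℂ) (hA : ∀ a, A a a = 0) :
    jordanWigner i A * jordanWigner j B = -(jordanWigner j B * jordanWigner i A) := by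
  have h1 := signString_mul_siteOp (Finset.mem_Iio.2 hij) hA
  have h2 : Commute (signString (Finset.Iio i)) (siteOp j B) :=
    commute_signString_siteOp (by simp [hij.le]) B
  have h3 := commute_siteOp hij.ne A B
  have h4 := commute_signString (Finset.Iio i) (Finset.Iio j)
  unfold jordanWigner
  calc signString (Finset.Iio i) * siteOp i A * (signString (Finset.Iio j) * siteOp j B)
      = signString (Finset.Iio i) * (siteOp i A * signString (Finset.Iio j)) * siteOp j B := by
        noncomm_ring
    _ = -((signString (Finset.Iio i) * signString (Finset.Iio j)) * (siteOp i A * siteOp j B)) := by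
        rw [← neg_eq_iff_eq_neg.mpr h1]; noncomm_ring
    _ = -(signString (Finset.Iio j) * (signString (Finset.Iio i) * siteOp j B) * siteOp i A) := by
        rw [h4.eq, h3.eq]; noncomm_ring
    _ = _ := by rw [h2.eq]; noncomm_ring

theorem jordanWigner_mul_of_ne {i j : Fin N} (hij : i ≠ j) {A B : Matrix (Fin 2) (Fin 2) ℂ}
    (hA : ∀ a, A a a = 0) (hB : ∀ a, B a a = 0) :
    jordanWigner i A * jordanWigner j B = -(jordanWigner j B * jordanWigner i A) := by
  rcases lt_or_gt_of_ne hij with h | h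
  · exact jordanWigner_mul_of_lt h B hA
  · rw [jordanWigner_mul_of_lt h A hB, neg_neg]

theorem jordanWigner_mul_self (i : Fin N) (A B : Matrix (Fin 2) (Fin 2) ℂ) :
    jordanWigner i A * jordanWigner i B = siteOp i (A * B) := by
  have h : Commute (signString (Finset.Iio i)) (siteOp i A) :=
    commute_signString_siteOp (by simp) A
  unfold jordanWigner
  rw [h.eq, mul_assoc, ← mul_assoc (signString _), signString_mul_self, one_mul,
    siteOp_mul_siteOp_self]

/-- The annihilation operator of a down spin at `i`. -/
def annihilate (i : Fin N) : ChainOp N := jordanWigner i spinRaise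

/-- The creation operator of a down spin at `i`. -/
def create (i : Fin N) : ChainOp N := jordanWigner i spinLower

theorem spinRaise_diag (a : Fin 2) : spinRaise a a = 0 := by
  fin_cases a <;> simp [spinRaise]

theorem spinLower_diag (a : Fin 2) : spinLower a a = 0 := by
  fin_cases a <;> simp [spinLower]

theorem isCAR_jordanWigner : IsCAR (annihilate (N := N)) create where
  cc i j := by
    rcases eq_or_ne i j with rfl | h
    · have h0 : spinRaise * spinRaise = 0 := by
        ext a b; fin_cases a <;> fin_cases b <;> simp [spinRaise]
      rw [annihilate, jordanWigner_mul_self, h0, siteOp_zero, neg_zero]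
    · exact jordanWigner_mul_of_ne h spinRaise_diag spinRaise_diag
  dd i j := by
    rcases eq_or_ne i j with rfl | h
    · have h0 : spinLower * spinLower = 0 := by
        ext a b; fin_cases a <;> fin_cases b <;> simp [spinLower]
      rw [create, jordanWigner_mul_self, h0, siteOp_zero, neg_zero]
    · exact jordanWigner_mul_of_ne h spinLower_diag spinLower_diag
  cd i j := by
    rcases eq_or_ne i j with rfl | h
    · have h0 : spinRaise * spinLower + spinLower * spinRaise = 1 := by
        ext a b; fin_cases a <;> fin_cases b <;> simp [spinLower, spinRaise]
      rw [annihilate, create, jordanWigner_mul_self, jordanWigner_mul_self, if_pos rfl,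
        eq_sub_iff_add_eq, ← siteOp_add, h0, siteOp_one]
    · rw [if_neg h, zero_sub]
      exact jordanWigner_mul_of_ne h spinRaise_diag spinLower_diag

/-- The parity `∏ᵢ 2 Sᶻᵢ` of the number of down spins. -/
def parity (N : ℕ) : ChainOp N := signString Finset.univ

theorem parity_mul_jordanWigner (i : Fin N) {A : Matrix (Fin 2) (Fin 2) ℂ}
    (hA : ∀ a, A a a = 0) :
    parity N * jordanWigner i A = -(jordanWigner i A * parity N) := by
  unfold parity jordanWigner
  rw [← mul_assoc, (commute_signString _ _).eq, mul_assoc,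
    signString_mul_siteOp (Finset.mem_univ i) hA, mul_neg, mul_assoc]

theorem commute_parity_hop (i j : Fin N) : Commute (parity N) (create i * annihilate j) := by
  have h1 : parity N * create i = -(create i * parity N) :=
    parity_mul_jordanWigner i spinLower_diag
  have h2 : parity N * annihilate j = -(annihilate j * parity N) :=
    parity_mul_jordanWigner j spinRaise_diag
  rw [Commute, SemiconjBy, ← mul_assoc, h1, neg_mul, mul_assoc, h2]
  noncomm_ring

/-- The number of down spins. -/
def downNumber (N : ℕ) : ChainOp N := ∑ i : Fin N, create i * annihilate i

theorem create_mul_annihilate_self (i : Fin N) :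
    create i * annihilate i = Matrix.diagonal fun σ => if σ i = 0 then 0 else 1 := by
  have h0 : spinLower * spinRaise = Matrix.diagonal fun a => if a = 0 then 0 else 1 := by
    ext a b; fin_cases a <;> fin_cases b <;> simp [spinLower, spinRaise]
  rw [annihilate, create, jordanWigner_mul_self, h0, siteOp_diagonal]

/-- The parity operator is the exponential of a multiple of the number operator; this makes it a
shift by `π i` of the mode energies. -/
theorem parity_eq_exp : parity N = exp ((Real.pi * Complex.I : ℂ) • downNumber N) := by
  have h : (Real.pi * Complex.I : ℂ) • downNumber N = Matrix.diagonal
      (fun σ : Fin N → Fin 2 => ∑ i, if σ i = 0 then 0 else Real.pi * Complex.I) := by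
    simp only [downNumber, create_mul_annihilate_self]
    ext σ τ
    rcases eq_or_ne σ τ with rfl | hne
    · simp [Matrix.sum_apply, Finset.mul_sum]
    · simp [Matrix.sum_apply, hne]
  rw [h, Matrix.exp_diagonal, parity, signString]
  congr 1
  funext σ
  rw [Pi.coe_exp, ← Complex.exp_eq_exp_ℂ, Complex.exp_sum]
  refine Finset.prod_congr rfl fun i _ => ?_
  unfold spinSign
  split_ifs <;> simp [Complex.exp_pi_mul_I]

theorem totalSpinZ_eq : totalSpinZ N = (N / 2 : ℂ) • 1 - downNumber N := by
  have h0 : spinZ = (1 / 2 : ℂ) • 1 + (-1 : ℂ) • (spinLower * spinRaise) := by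
    ext a b; fin_cases a <;> fin_cases b <;> simp [spinLower, spinRaise, spinZ]; norm_num
  simp only [totalSpinZ, downNumber, create, annihilate, jordanWigner_mul_self, h0, siteOp_add,
    siteOp_smul, siteOp_neg, siteOp_one, Finset.sum_add_distrib, Finset.sum_const, Finset.card_univ,
    Fintype.card_fin, neg_one_smul, Finset.sum_neg_distrib, sub_eq_add_neg]
  rw [← Nat.cast_smul_eq_nsmul ℂ, smul_smul]
  congr 2
  ring

end JordanWigner

/-! ### The XX chain as free fermions in each parity sector -/

section SemiconjBy

open scoped Matrix.Norms.Operator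

theorem semiconjBy_exp {m : Type*} [Fintype m] [DecidableEq m] {Q A B : Matrix m m ℂ}
    (h : SemiconjBy Q A B) : SemiconjBy Q (exp A) (exp B) := h.exp_right

end SemiconjBy

section Sectors

variable {M : ℕ}

/-- On neighbouring sites the two Jordan-Wigner strings cancel up to the sign at the first site. -/
theorem jordanWigner_mul_bulk (i : Fin M) (A B : Matrix (Fin 2) (Fin 2) ℂ) :
    jordanWigner i.castSucc A * jordanWigner i.succ B
      = siteOp i.castSucc (A * Matrix.diagonal spinSign) * siteOp i.succ B := by
  have hI : Finset.Iio i.succ = insert i.castSucc (Finset.Iio i.castSucc) := by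
    ext j
    simp only [Finset.mem_Iio, Finset.mem_insert, Fin.lt_def, Fin.ext_iff, Fin.val_succ,
      Fin.val_castSucc]
    omega
  have hi : i.castSucc ∉ Finset.Iio i.castSucc := by simp
  have h1 := commute_signString_siteOp hi A
  have h2 := commute_signString_siteOp hi (Matrix.diagonal spinSign)
  unfold jordanWigner
  rw [hI, signString_insert hi, h1.eq, ← h2.eq, mul_assoc, ← mul_assoc (signString _),
    ← mul_assoc (signString _), signString_mul_self, one_mul, ← mul_assoc,
    siteOp_mul_siteOp_self]

/-- Across the bond that closes the ring, the Jordan-Wigner strings add up to the parity. -/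
theorem jordanWigner_mul_boundary (A B : Matrix (Fin 2) (Fin 2) ℂ) :
    jordanWigner (Fin.last M) A * jordanWigner 0 B
      = parity (M + 1) * (siteOp (Fin.last M) (Matrix.diagonal spinSign * A) * siteOp 0 B) := by
  have hI : Finset.univ = insert (Fin.last M) (Finset.Iio (Fin.last M)) := by
    ext j
    simp only [Finset.mem_univ, Finset.mem_insert, Finset.mem_Iio, true_iff]
    exact (Fin.le_last j).eq_or_lt
  have hi : Fin.last M ∉ Finset.Iio (Fin.last M) := by simp
  have h0 : Finset.Iio (0 : Fin (M + 1)) = ∅ := by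
    ext j; simp
  have h2 := commute_signString_siteOp hi (Matrix.diagonal spinSign)
  have hz : siteOp (Fin.last M) (Matrix.diagonal spinSign)
      * siteOp (Fin.last M) (Matrix.diagonal spinSign) = 1 := by
    rw [siteOp_mul_siteOp_self, Matrix.diagonal_mul_diagonal]
    simp only [spinSign_mul_self, Matrix.diagonal_one, siteOp_one]
  have h3 : signString (Finset.Iio (Fin.last M))
      = parity (M + 1) * siteOp (Fin.last M) (Matrix.diagonal spinSign) := by
    rw [parity, hI, signString_insert hi, ← h2.eq, mul_assoc, hz, mul_one]
  unfold jordanWigner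
  rw [h0, signString_empty, one_mul, h3, ← siteOp_mul_siteOp_self]
  noncomm_ring

theorem spinLower_mul_sign : spinLower * Matrix.diagonal spinSign = spinLower := by
  ext a b; fin_cases a <;> fin_cases b <;> simp [spinLower, spinSign]

theorem spinRaise_mul_sign : spinRaise * Matrix.diagonal spinSign = -spinRaise := by
  ext a b; fin_cases a <;> fin_cases b <;> simp [spinRaise, spinSign]

theorem sign_mul_spinLower : Matrix.diagonal spinSign * spinLower = -spinLower := by
  ext a b; fin_cases a <;> fin_cases b <;> simp [spinLower, spinSign]

theorem sign_mul_spinRaise : Matrix.diagonal spinSign * spinRaise = spinRaise := by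
  ext a b; fin_cases a <;> fin_cases b <;> simp [spinRaise, spinSign]

/-- The exchange operator of two sites, `S^-ᵢ S^+ⱼ + S^+ᵢ S^-ⱼ`. -/
def exchange {N : ℕ} (i j : Fin N) : ChainOp N :=
  siteOp i spinLower * siteOp j spinRaise + siteOp i spinRaise * siteOp j spinLower

theorem exchange_bulk (i : Fin M) :
    exchange i.castSucc i.succ
      = create i.castSucc * annihilate i.succ + create i.succ * annihilate i.castSucc := by
  have h1 := jordanWigner_mul_bulk i spinLower spinRaise
  have h2 := jordanWigner_mul_bulk i spinRaise spinLower
  rw [spinLower_mul_sign] at h1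
  rw [spinRaise_mul_sign, siteOp_neg, neg_mul] at h2
  rw [exchange, ← h1, ← neg_eq_iff_eq_neg.mpr h2,
    jordanWigner_mul_of_ne (Fin.castSucc_lt_succ).ne spinRaise_diag spinLower_diag, neg_neg]
  rfl

theorem parity_mul_self (N : ℕ) : parity N * parity N = 1 := signString_mul_self _

theorem parity_mul_exchange_boundary (hM : M ≠ 0) :
    parity (M + 1) * exchange (Fin.last M) 0
      = -(create (Fin.last M) * annihilate 0 + create 0 * annihilate (Fin.last M)) := by
  have h1 := jordanWigner_mul_boundary (M := M) spinLower spinRaise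
  have h2 := jordanWigner_mul_boundary (M := M) spinRaise spinLower
  have hne : Fin.last M ≠ 0 := by simpa [Fin.ext_iff] using hM
  rw [sign_mul_spinLower, siteOp_neg, neg_mul, mul_neg] at h1
  rw [sign_mul_spinRaise, jordanWigner_mul_of_ne hne spinRaise_diag spinLower_diag] at h2
  rw [exchange, mul_add, ← h2, ← neg_eq_iff_eq_neg.mpr h1, neg_add]
  rfl

theorem spinX_spinY_eq_exchange {N : ℕ} (i j : Fin N) :
    siteOp i spinX * siteOp j spinX + siteOp i spinY * siteOp j spinY
      = (1 / 2 : ℂ) • exchange i j := by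
  have hX : spinX = (1 / 2 : ℂ) • (spinRaise + spinLower) := by
    ext a b; fin_cases a <;> fin_cases b <;> simp [spinX, spinRaise, spinLower]
  have hY : spinY = (Complex.I / 2) • (spinLower + (-1 : ℂ) • spinRaise) := by
    ext a b
    fin_cases a <;> fin_cases b <;> simp [spinY, spinRaise, spinLower]
    ring
  have hI : Complex.I / 2 * (Complex.I / 2) = -(1 / 4) := by
    linear_combination (1 / 4 : ℂ) * Complex.I_mul_I
  rw [hX, hY, exchange]
  simp only [siteOp_smul, siteOp_neg, siteOp_add, smul_mul_smul_comm, hI, mul_add, add_mul, neg_smul,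
    one_smul, mul_neg, neg_mul]
  module

/-- Hopping of the Jordan-Wigner fermions on the ring, with a factor `ζ` on the bond that closes
the ring: `ζ = 1` and `ζ = -1` are periodic and antiperiodic boundary conditions. -/
def twistedHop (M : ℕ) (ζ : ℂ) : ChainOp (M + 1) :=
  (1 / 2 : ℂ) • (∑ i : Fin M, (create i.castSucc * annihilate i.succ
      + create i.succ * annihilate i.castSucc)
    + ζ • (create (Fin.last M) * annihilate 0 + create 0 * annihilate (Fin.last M)))

/-- The free-fermion Hamiltonian with boundary twist `ζ`. -/
def fermionHamiltonian (M : ℕ) (J h : ℝ) (ζ : ℂ) : ChainOp (M + 1) :=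
  (-(h * (M + 1 : ℕ) / 2 : ℂ)) • 1 + (h : ℂ) • downNumber (M + 1) - (J : ℂ) • twistedHop M ζ

theorem hamiltonianXY_eq (J h : ℝ) :
    hamiltonianXY (M + 1) J 0 h = (-(h * (M + 1 : ℕ) / 2 : ℂ)) • 1
      + (h : ℂ) • downNumber (M + 1)
      - (J : ℂ) • (1 / 2 : ℂ) • (∑ i : Fin M, exchange i.castSucc i.succ
        + exchange (Fin.last M) 0) := by
  have h1 : ∑ i : Fin (M + 1), exchange i (finRotate (M + 1) i)
      = ∑ i : Fin M, exchange i.castSucc i.succ + exchange (Fin.last M) 0 := by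
    rw [Fin.sum_univ_castSucc, finRotate_last]
    simp only [finRotate_apply, Fin.coeSucc_eq_succ]
  have h2 : ∑ i : Fin (M + 1), siteOp i spinZ = totalSpinZ (M + 1) := rfl
  rw [hamiltonianXY, h2, totalSpinZ_eq, ← h1]
  simp only [add_zero, sub_zero, Complex.ofReal_one, one_smul, spinX_spinY_eq_exchange,
    ← Finset.smul_sum]
  module

theorem commute_parity_twistedHop (ζ : ℂ) : Commute (parity (M + 1)) (twistedHop M ζ) := by
  refine Commute.smul_right (.add_right (.sum_right _ _ _ fun i _ => ?_) (.smul_right ?_ _)) _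
  · exact (commute_parity_hop _ _).add_right (commute_parity_hop _ _)
  · exact (commute_parity_hop _ _).add_right (commute_parity_hop _ _)

theorem commute_parity_downNumber (N : ℕ) : Commute (parity N) (downNumber N) :=
  .sum_right _ _ _ fun _ _ => commute_parity_hop _ _

theorem commute_parity_fermionHamiltonian (J h : ℝ) (ζ : ℂ) :
    Commute (parity (M + 1)) (fermionHamiltonian M J h ζ) :=
  .sub_right (.add_right ((Commute.one_right _).smul_right _)
    ((commute_parity_downNumber _).smul_right _)) ((commute_parity_twistedHop ζ).smul_right _)

/-- In the sector of parity `p = ±1` the spin chain is a free-fermion chain with boundary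
twist `-p`. -/
theorem sector_mul_hamiltonianXY (hM : M ≠ 0) (J h : ℝ) {p : ℂ} (hp : p * p = 1) :
    (1 + p • parity (M + 1)) * hamiltonianXY (M + 1) J 0 h
      = fermionHamiltonian M J h (-p) * (1 + p • parity (M + 1)) := by
  have hc : Commute (1 + p • parity (M + 1)) (fermionHamiltonian M J h (-p)) :=
    (Commute.one_left _).add_left ((commute_parity_fermionHamiltonian J h (-p)).smul_left p)
  rw [← hc.eq, hamiltonianXY_eq, fermionHamiltonian, twistedHop]
  have hP := parity_mul_self (M + 1)
  have hb := parity_mul_exchange_boundary hM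
  have hQ : (1 + p • parity (M + 1)) * parity (M + 1) = p • (1 + p • parity (M + 1)) := by
    rw [add_mul, one_mul, smul_mul_assoc, hP, smul_add, smul_smul, hp, one_smul]
    exact add_comm _ _
  have hx : (1 + p • parity (M + 1)) * exchange (Fin.last M) 0
      = (1 + p • parity (M + 1)) * ((-p) • (create (Fin.last M) * annihilate 0
          + create 0 * annihilate (Fin.last M))) := by
    have h1 : exchange (Fin.last M) 0 = parity (M + 1) * -(create (Fin.last M) * annihilate 0
          + create 0 * annihilate (Fin.last M)) := by
      rw [← hb, ← mul_assoc, hP, one_mul]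
    rw [h1, ← mul_assoc, hQ, smul_mul_assoc, ← mul_smul_comm, smul_neg, neg_smul]
  simp only [mul_sub, mul_add _ (_ • _), mul_smul_comm, mul_add _ (Finset.sum _ _), hx,
    exchange_bulk]

/-- Decomposition of the Gibbs operator into the two parity sectors. -/
theorem exp_hamiltonianXY (hM : M ≠ 0) (J h β : ℝ) :
    exp ((-(β : ℂ)) • hamiltonianXY (M + 1) J 0 h)
      = (1 / 2 : ℂ) •
        (exp ((-(β : ℂ)) • fermionHamiltonian M J h (-1)) * (1 + parity (M + 1))
        + exp ((-(β : ℂ)) • fermionHamiltonian M J h 1) * (1 - parity (M + 1))) := by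
  have key : ∀ p : ℂ, p * p = 1 →
      exp ((-(β : ℂ)) • fermionHamiltonian M J h (-p)) * (1 + p • parity (M + 1))
        = (1 + p • parity (M + 1)) * exp ((-(β : ℂ)) • hamiltonianXY (M + 1) J 0 h) := by
    intro p hp
    have h1 : SemiconjBy (1 + p • parity (M + 1)) ((-(β : ℂ)) • hamiltonianXY (M + 1) J 0 h)
        ((-(β : ℂ)) • fermionHamiltonian M J h (-p)) := by
      rw [SemiconjBy, mul_smul_comm, smul_mul_assoc, sector_mul_hamiltonianXY hM J h hp]
    exact (semiconjBy_exp h1).eq.symm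
  have k1 := key 1 (one_mul 1)
  have k2 := key (-1) (by norm_num)
  rw [neg_neg, neg_one_smul, ← sub_eq_add_neg] at k2
  rw [one_smul] at k1
  rw [k1, k2, ← add_mul, ← smul_mul_assoc]
  have : (1 / 2 : ℂ) • (1 + parity (M + 1) + (1 - parity (M + 1))) = 1 := by module
  rw [this, one_mul]

end Sectors

/-! ### Momentum modes and the exact finite-size magnetization -/

section Momentum

variable {M : ℕ}

/-- The momentum `2π (k + α) / N`; `α = 0` and `α = 1 / 2` fit periodic and antiperiodic boundary
conditions. -/
def momentum (N : ℕ) (α : ℝ) (k : ℕ) : ℝ := 2 * Real.pi * ((k + α) / N)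

/-- The phase `exp (i φ)` of the momentum `φ`. -/
def phase (N : ℕ) (α : ℝ) (k : ℕ) : ℂ := Complex.exp (momentum N α k * Complex.I)

theorem phase_ne_zero (N : ℕ) (α : ℝ) (k : ℕ) : phase N α k ≠ 0 := Complex.exp_ne_zero _

theorem phase_eq (N : ℕ) (α : ℝ) (k : ℕ) :
    phase N α k = phase N α 0 * Complex.exp (2 * Real.pi * Complex.I / N) ^ k := by
  rw [phase, phase, ← Complex.exp_nat_mul, ← Complex.exp_add]
  congr 1
  simp only [momentum]
  push_cast
  ring

theorem phase_pow {N : ℕ} (hN : N ≠ 0) (α : ℝ) (k : ℕ) :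
    phase N α k ^ N = Complex.exp (2 * Real.pi * α * Complex.I) := by
  have hN' : (N : ℂ) ≠ 0 := Nat.cast_ne_zero.2 hN
  rw [phase, ← Complex.exp_nat_mul,
    ← mul_one (Complex.exp (2 * Real.pi * α * Complex.I)),
    ← Complex.exp_nat_mul_two_pi_mul_I k, ← Complex.exp_add]
  congr 1
  simp only [momentum]
  push_cast
  field_simp
  ring

theorem phase_orthogonal {N : ℕ} (α : ℝ) (k l : Fin N) :
    ∑ i : Fin N, ((phase N α k)⁻¹ ^ (i : ℕ) / N) * phase N α l ^ (i : ℕ)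
      = if k = l then 1 else 0 := by
  have hN : N ≠ 0 := fun h => (h ▸ k).elim0
  have hN' : (N : ℂ) ≠ 0 := Nat.cast_ne_zero.2 hN
  have hk := phase_ne_zero N α k
  have h1 : ∑ i : Fin N, ((phase N α k)⁻¹ ^ (i : ℕ) / N) * phase N α l ^ (i : ℕ)
      = (∑ i ∈ Finset.range N, ((phase N α k)⁻¹ * phase N α l) ^ i) / N := by
    rw [Finset.sum_div, Finset.sum_range]
    refine Finset.sum_congr rfl fun i _ => ?_
    rw [mul_pow]; ring
  rw [h1]
  split_ifs with h
  · subst h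
    simp [inv_mul_cancel₀ hk, hN']
  · have hne : (phase N α k)⁻¹ * phase N α l ≠ 1 := by
      intro h2
      have h3 : phase N α l = phase N α k := by
        rw [← mul_one (phase N α k), ← h2, mul_inv_cancel_left₀ hk]
      rw [phase_eq N α k, phase_eq N α l] at h3
      have h4 := mul_left_cancel₀ (phase_ne_zero N α 0) h3
      exact h (Fin.ext ((Complex.isPrimitiveRoot_exp N hN).pow_inj l.2 k.2 h4).symm)
    rw [geom_sum_eq hne, mul_pow, inv_pow, phase_pow hN, phase_pow hN,
      inv_mul_cancel₀ (Complex.exp_ne_zero _), sub_self, zero_div, zero_div]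

theorem phase_orthogonal' {N : ℕ} (α : ℝ) (i j : Fin N) :
    ∑ k : Fin N, phase N α k ^ (i : ℕ) * ((phase N α k)⁻¹ ^ (j : ℕ) / N)
      = if i = j then 1 else 0 := by
  let W : Matrix (Fin N) (Fin N) ℂ := Matrix.of fun k i => (phase N α k)⁻¹ ^ (i : ℕ) / N
  let V : Matrix (Fin N) (Fin N) ℂ := Matrix.of fun i k => phase N α k ^ (i : ℕ)
  have h : W * V = 1 := by
    ext k l
    rw [Matrix.mul_apply, Matrix.one_apply, ← phase_orthogonal α k l]
    rfl
  have hVW : V * W = 1 := mul_eq_one_comm.mp h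
  have h' := congrFun₂ hVW i j
  rw [Matrix.mul_apply, Matrix.one_apply] at h'
  rw [← h']
  rfl

/-- The annihilation operator of the momentum mode `k`. -/
def modeAnnihilate (N : ℕ) (α : ℝ) (k : Fin N) : ChainOp N :=
  ∑ i : Fin N, ((phase N α k)⁻¹ ^ (i : ℕ) / N) • annihilate i

/-- The creation operator of the momentum mode `k`.  The normalization `1 / N` of the Fourier
transform is put entirely into `modeAnnihilate`. -/
def modeCreate (N : ℕ) (α : ℝ) (k : Fin N) : ChainOp N :=
  ∑ i : Fin N, (phase N α k ^ (i : ℕ)) • create i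

theorem isCAR_mode (N : ℕ) (α : ℝ) : IsCAR (modeAnnihilate N α) (modeCreate N α) :=
  isCAR_jordanWigner.changeModes (phase_orthogonal α)

theorem annihilate_eq_sum_mode {N : ℕ} (α : ℝ) (i : Fin N) :
    annihilate i = ∑ k : Fin N, (phase N α k ^ (i : ℕ)) • modeAnnihilate N α k := by
  simp only [modeAnnihilate, Finset.smul_sum, smul_smul]
  rw [Finset.sum_comm]
  simp only [← Finset.sum_smul, phase_orthogonal', ite_smul, one_smul, zero_smul]
  simp

theorem create_eq_sum_mode {N : ℕ} (α : ℝ) (i : Fin N) :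
    create i = ∑ k : Fin N, ((phase N α k)⁻¹ ^ (i : ℕ) / N) • modeCreate N α k := by
  simp only [modeCreate, Finset.smul_sum, smul_smul]
  rw [Finset.sum_comm]
  have h : ∀ j : Fin N, ∑ k : Fin N, (phase N α k)⁻¹ ^ (i : ℕ) / N * phase N α k ^ (j : ℕ)
      = if j = i then 1 else 0 := fun j => by
    rw [← phase_orthogonal' α j i]
    exact Finset.sum_congr rfl fun k _ => mul_comm _ _
  simp only [← Finset.sum_smul, h, ite_smul, one_smul, zero_smul]
  simp

/-- Translation-invariant quadratic forms are diagonal in the momentum modes. -/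
theorem sum_mode_mul_mode {N : ℕ} (α : ℝ) (a b : Fin N → ℂ) :
    ∑ i : Fin N, (∑ k, (a k * ((phase N α k)⁻¹ ^ (i : ℕ) / N)) • modeCreate N α k)
        * (∑ l, (b l * phase N α l ^ (i : ℕ)) • modeAnnihilate N α l)
      = ∑ k, (a k * b k) • (modeCreate N α k * modeAnnihilate N α k) := by
  simp only [Finset.sum_mul_sum, smul_mul_smul_comm]
  rw [Finset.sum_comm]
  refine Finset.sum_congr rfl fun k _ => ?_
  rw [Finset.sum_comm]
  have h : ∀ l : Fin N, ∑ i : Fin N, (a k * ((phase N α k)⁻¹ ^ (i : ℕ) / N))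
      * (b l * phase N α l ^ (i : ℕ)) = if k = l then a k * b l else 0 := fun l => by
    rw [← mul_boole, ← phase_orthogonal α k l, Finset.mul_sum]
    exact Finset.sum_congr rfl fun i _ => by ring
  simp only [← Finset.sum_smul, h, ite_smul, zero_smul]
  simp

theorem downNumber_eq_sum_mode (N : ℕ) (α : ℝ) :
    downNumber N = ∑ k, modeCreate N α k * modeAnnihilate N α k := by
  have h := sum_mode_mul_mode (N := N) α 1 1
  simp only [Pi.one_apply, one_mul, one_smul, ← create_eq_sum_mode, ← annihilate_eq_sum_mode] at h
  exact h

theorem twistedHop_eq_sum_mode {α : ℝ} {ζ : ℂ}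
    (hα : Complex.exp (2 * Real.pi * α * Complex.I) = ζ) (hζ : ζ⁻¹ = ζ) :
    twistedHop M ζ = ∑ k : Fin (M + 1), (Real.cos (momentum (M + 1) α k) : ℂ)
      • (modeCreate (M + 1) α k * modeAnnihilate (M + 1) α k) := by
  have hpow : ∀ k, phase (M + 1) α k ^ (M + 1) = ζ := fun k => by
    rw [phase_pow (Nat.succ_ne_zero M), hα]
  have h1 := sum_mode_mul_mode (N := M + 1) α 1 (fun k => phase (M + 1) α k)
  have h2 := sum_mode_mul_mode (N := M + 1) α (fun k => (phase (M + 1) α k)⁻¹) 1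
  have hc : ∀ i : Fin M, ∑ l : Fin (M + 1), (phase (M + 1) α l * phase (M + 1) α l ^ (i : ℕ))
      • modeAnnihilate (M + 1) α l = annihilate i.succ := fun i => by
    rw [annihilate_eq_sum_mode α]
    exact Finset.sum_congr rfl fun k _ => by rw [Fin.val_succ, pow_succ']
  have hcl : ∑ l : Fin (M + 1), (phase (M + 1) α l * phase (M + 1) α l ^ M)
      • modeAnnihilate (M + 1) α l = ζ • annihilate 0 := by
    rw [annihilate_eq_sum_mode α, Finset.smul_sum]
    refine Finset.sum_congr rfl fun k _ => ?_
    rw [← pow_succ', hpow, Fin.val_zero, pow_zero, one_smul]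
  have hd : ∀ i : Fin M, ∑ k : Fin (M + 1), ((phase (M + 1) α k)⁻¹
      * ((phase (M + 1) α k)⁻¹ ^ (i : ℕ) / (M + 1 : ℕ)))
      • modeCreate (M + 1) α k = create i.succ := fun i => by
    rw [create_eq_sum_mode α]
    refine Finset.sum_congr rfl fun k _ => ?_
    rw [Fin.val_succ, pow_succ', mul_div_assoc]
  have hdl : ∑ k : Fin (M + 1), ((phase (M + 1) α k)⁻¹
      * ((phase (M + 1) α k)⁻¹ ^ M / (M + 1 : ℕ)))
      • modeCreate (M + 1) α k = ζ • create 0 := by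
    rw [create_eq_sum_mode α, Finset.smul_sum]
    refine Finset.sum_congr rfl fun k _ => ?_
    rw [← mul_div_assoc, ← pow_succ', inv_pow, hpow, Fin.val_zero, pow_zero, hζ, smul_smul]
    congr 1
    ring
  simp only [Pi.one_apply, one_mul, mul_one, ← create_eq_sum_mode,
    ← annihilate_eq_sum_mode] at h1 h2
  rw [Fin.sum_univ_castSucc] at h1 h2
  simp only [Fin.val_castSucc, Fin.val_last, hc, hcl, hd, hdl] at h1 h2
  have hcos : ∀ k : ℕ, (Real.cos (momentum (M + 1) α k) : ℂ)
      = (1 / 2) * (phase (M + 1) α k + (phase (M + 1) α k)⁻¹) := fun k => by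
    rw [Complex.ofReal_cos, Complex.cos, phase, ← Complex.exp_neg]
    ring_nf
  simp only [hcos, mul_smul, add_smul, ← Finset.smul_sum, Finset.sum_add_distrib]
  rw [← h1, ← h2, twistedHop, Finset.sum_add_distrib]
  simp only [mul_smul_comm, smul_mul_assoc, smul_add]
  abel

/-- The Boltzmann factor `e^{-β (h - J cos φ)}` of a momentum mode. -/
def boltzmann (J h β φ : ℝ) : ℝ := Real.exp (-(β * (h - J * Real.cos φ)))

/-- `∏ₖ (1 + ε xₖ)` over the Boltzmann factors `xₖ` of the `N` modes. -/
def modeProd (J h β : ℝ) (N : ℕ) (α ε : ℝ) : ℝ :=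
  ∏ k ∈ Finset.range N, (1 + ε * boltzmann J h β (momentum N α k))

/-- `∑ₖ ε xₖ / (1 + ε xₖ)` over the Boltzmann factors `xₖ` of the `N` modes. -/
def modeSum (J h β : ℝ) (N : ℕ) (α ε : ℝ) : ℝ :=
  ∑ k ∈ Finset.range N, ε * boltzmann J h β (momentum N α k)
    / (1 + ε * boltzmann J h β (momentum N α k))

theorem exp_fermionHamiltonian {α : ℝ} {ζ : ℂ}
    (hα : Complex.exp (2 * Real.pi * α * Complex.I) = ζ) (hζ : ζ⁻¹ = ζ) (J h β : ℝ) (s : ℂ) :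
    exp ((-(β : ℂ)) • fermionHamiltonian M J h ζ + s • downNumber (M + 1))
      = Complex.exp (β * h * (M + 1 : ℕ) / 2) • exp (∑ k : Fin (M + 1),
        ((-(β * (h - J * Real.cos (momentum (M + 1) α k))) : ℝ) + s : ℂ)
          • (modeCreate (M + 1) α k * modeAnnihilate (M + 1) α k)) := by
  have h1 : (-(β : ℂ)) • fermionHamiltonian M J h ζ + s • downNumber (M + 1)
      = (β * h * (M + 1 : ℕ) / 2 : ℂ) • 1 + ∑ k : Fin (M + 1),
        ((-(β * (h - J * Real.cos (momentum (M + 1) α k))) : ℝ) + s : ℂ)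
          • (modeCreate (M + 1) α k * modeAnnihilate (M + 1) α k) := by
    have h2 : ∑ k : Fin (M + 1),
        ((-(β * (h - J * Real.cos (momentum (M + 1) α k))) : ℝ) + s : ℂ)
          • (modeCreate (M + 1) α k * modeAnnihilate (M + 1) α k)
        = (-(β * h) + s : ℂ) • downNumber (M + 1) + (β * J : ℂ) • twistedHop M ζ := by
      rw [twistedHop_eq_sum_mode hα hζ, downNumber_eq_sum_mode (M + 1) α, Finset.smul_sum,
        Finset.smul_sum, ← Finset.sum_add_distrib]
      refine Finset.sum_congr rfl fun k _ => ?_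
      rw [smul_smul, ← add_smul]
      congr 1
      push_cast
      ring
    rw [h2, fermionHamiltonian]
    module
  rw [h1, Matrix.exp_add_of_commute _ _ ((Commute.one_left _).smul_left _),
    exp_smul_of_isIdempotentElem (one_mul 1), sub_smul, one_smul, add_sub_cancel,
    smul_mul_assoc, one_mul]

theorem commute_fermionHamiltonian_downNumber {α : ℝ} {ζ : ℂ}
    (hα : Complex.exp (2 * Real.pi * α * Complex.I) = ζ) (hζ : ζ⁻¹ = ζ) (J h : ℝ) :
    Commute (fermionHamiltonian M J h ζ) (downNumber (M + 1)) := by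
  refine .sub_left (.add_left ((Commute.one_left _).smul_left _)
    ((Commute.refl _).smul_left _)) (.smul_left ?_ _)
  rw [twistedHop_eq_sum_mode hα hζ, downNumber_eq_sum_mode (M + 1) α]
  exact .sum_left _ _ _ fun k _ => .sum_right _ _ _ fun l _ =>
    ((isCAR_mode (M + 1) α).commute_number k l).smul_left _

theorem exp_fermionHamiltonian_mul_parity {α : ℝ} {ζ : ℂ}
    (hα : Complex.exp (2 * Real.pi * α * Complex.I) = ζ) (hζ : ζ⁻¹ = ζ) (J h β : ℝ) :
    exp ((-(β : ℂ)) • fermionHamiltonian M J h ζ) * parity (M + 1)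
      = exp ((-(β : ℂ)) • fermionHamiltonian M J h ζ
        + (Real.pi * Complex.I : ℂ) • downNumber (M + 1)) := by
  rw [parity_eq_exp, Matrix.exp_add_of_commute]
  exact ((commute_fermionHamiltonian_downNumber hα hζ J h).smul_left _).smul_right _

/-- Partition function of the free-fermion chain with a complex shift `s` of the mode energies,
where `e^s = ε`. -/
theorem trace_exp_fermionHamiltonian {α : ℝ} {ζ : ℂ}
    (hα : Complex.exp (2 * Real.pi * α * Complex.I) = ζ) (hζ : ζ⁻¹ = ζ) (J h β : ℝ) {s : ℂ}
    {ε : ℝ} (hs : Complex.exp s = ε) :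
    (exp ((-(β : ℂ)) • fermionHamiltonian M J h ζ + s • downNumber (M + 1))).trace
      = Complex.exp (β * h * (M + 1 : ℕ) / 2) *
        modeProd J h β (M + 1) α ε := by
  rw [exp_fermionHamiltonian hα hζ, Matrix.trace_smul, (isCAR_mode (M + 1) α).trace_exp_sum,
    smul_eq_mul, Finset.prod_div_distrib, Finset.prod_const, Finset.card_univ, Fintype.card_fin,
    Fintype.card_fun, Fintype.card_fin, Fintype.card_fin, modeProd, Finset.prod_range]
  push_cast
  rw [mul_div_cancel₀ _ (pow_ne_zero _ two_ne_zero)]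
  congr 1
  refine Finset.prod_congr rfl fun k _ => ?_
  rw [Complex.exp_add, hs, boltzmann]
  push_cast
  ring

theorem trace_downNumber_mul_exp_fermionHamiltonian {α : ℝ} {ζ : ℂ}
    (hα : Complex.exp (2 * Real.pi * α * Complex.I) = ζ) (hζ : ζ⁻¹ = ζ) (J h β : ℝ) {s : ℂ}
    {ε : ℝ} (hs : Complex.exp s = ε)
    (hε : ∀ k, 1 + ε * boltzmann J h β (momentum (M + 1) α k) ≠ 0) :
    (downNumber (M + 1)
        * exp ((-(β : ℂ)) • fermionHamiltonian M J h ζ + s • downNumber (M + 1))).trace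
      = Complex.exp (β * h * (M + 1 : ℕ) / 2) *
        (modeProd J h β (M + 1) α ε * modeSum J h β (M + 1) α ε : ℝ) := by
  have hZ := trace_exp_fermionHamiltonian (M := M) hα hζ J h β hs
  have hb : ∀ k : ℕ, Complex.exp
      ((-(β * (h - J * Real.cos (momentum (M + 1) α k))) : ℝ) + s : ℂ)
        = (ε * boltzmann J h β (momentum (M + 1) α k) : ℝ) := fun k => by
    rw [Complex.exp_add, hs, boltzmann]
    push_cast
    ring
  rw [Complex.ofReal_mul, ← mul_assoc, ← hZ, modeSum, Finset.sum_range, Complex.ofReal_sum,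
    downNumber_eq_sum_mode (M + 1) α, Finset.sum_mul, Matrix.trace_sum, Finset.mul_sum,
    ← downNumber_eq_sum_mode (M + 1) α]
  refine Finset.sum_congr rfl fun k _ => ?_
  have h1 := (isCAR_mode (M + 1) α).trace_number_mul_exp_sum
    (fun k => ((-(β * (h - J * Real.cos (momentum (M + 1) α k))) : ℝ) + s : ℂ))
    (Finset.mem_univ k)
  rw [exp_fermionHamiltonian hα hζ, mul_smul_comm, Matrix.trace_smul, Matrix.trace_smul,
    smul_eq_mul, smul_eq_mul]
  rw [hb] at h1
  have hε' : (1 + (ε * boltzmann J h β (momentum (M + 1) α k) : ℝ) : ℂ) ≠ 0 := by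
    exact_mod_cast hε k
  rw [Complex.ofReal_div, Complex.ofReal_add, Complex.ofReal_one, mul_div_assoc',
    eq_div_iff hε']
  linear_combination Complex.exp (β * h * (M + 1 : ℕ) / 2) * h1

end Momentum

section FiniteSize

variable {J h β : ℝ}

theorem boltzmann_pos (J h β φ : ℝ) : 0 < boltzmann J h β φ := Real.exp_pos _

theorem boltzmann_le (hJ : 0 < J) (hβ : 0 < β) (φ : ℝ) :
    boltzmann J h β φ ≤ Real.exp (-(β * (h - J))) := by
  have := Real.cos_le_one φ
  exact Real.exp_le_exp.2 (neg_le_neg (mul_le_mul_of_nonneg_left (by nlinarith) hβ.le))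

theorem le_boltzmann (hJ : 0 < J) (hβ : 0 < β) (φ : ℝ) :
    Real.exp (-(β * (h + J))) ≤ boltzmann J h β φ := by
  have := Real.neg_one_le_cos φ
  exact Real.exp_le_exp.2 (neg_le_neg (mul_le_mul_of_nonneg_left (by nlinarith) hβ.le))

theorem exp_gap_lt_one (hh : J < h) (hβ : 0 < β) : Real.exp (-(β * (h - J))) < 1 :=
  Real.exp_lt_one_iff.2 (neg_neg_of_pos (mul_pos hβ (sub_pos.2 hh)))

/-- The exact magnetization of the finite ring: the two parity sectors contribute the boundary
conditions `α = 1 / 2` and `α = 0`. -/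
theorem finiteMagnetization_eq (hJ : 0 < J) (hh : J < h) (hβ : 0 < β) {M : ℕ} (hM : M ≠ 0)
    (hZ : modeProd J h β (M + 1) (1 / 2) 1 + modeProd J h β (M + 1) (1 / 2) (-1)
      + (modeProd J h β (M + 1) 0 1 - modeProd J h β (M + 1) 0 (-1)) ≠ 0) :
    finiteMagnetization J h β (M + 1) = 1 / 2 -
      (modeProd J h β (M + 1) (1 / 2) 1 * modeSum J h β (M + 1) (1 / 2) 1
        + modeProd J h β (M + 1) (1 / 2) (-1) * modeSum J h β (M + 1) (1 / 2) (-1)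
        + (modeProd J h β (M + 1) 0 1 * modeSum J h β (M + 1) 0 1
        - modeProd J h β (M + 1) 0 (-1) * modeSum J h β (M + 1) 0 (-1)))
      / (modeProd J h β (M + 1) (1 / 2) 1 + modeProd J h β (M + 1) (1 / 2) (-1)
        + (modeProd J h β (M + 1) 0 1 - modeProd J h β (M + 1) 0 (-1))) / (M + 1 : ℕ) := by
  have hα0 : Complex.exp (2 * Real.pi * (0 : ℝ) * Complex.I) = 1 := by simp
  have hα1 : Complex.exp (2 * Real.pi * (1 / 2 : ℝ) * Complex.I) = -1 := by
    rw [← Complex.exp_pi_mul_I]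
    congr 1
    push_cast
    ring
  have hζ0 : (1 : ℂ)⁻¹ = 1 := inv_one
  have hζ1 : (-1 : ℂ)⁻¹ = -1 := by norm_num
  have hs0 : Complex.exp 0 = (1 : ℝ) := by simp
  have hs1 : Complex.exp (Real.pi * Complex.I) = (-1 : ℝ) := by simp [Complex.exp_pi_mul_I]
  have hx : ∀ φ, boltzmann J h β φ < 1 := fun φ =>
    (boltzmann_le hJ hβ φ).trans_lt (exp_gap_lt_one hh hβ)
  have hε0 : ∀ α : ℝ, ∀ k, 1 + 1 * boltzmann J h β (momentum (M + 1) α k) ≠ 0 := fun α k => by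
    have := boltzmann_pos J h β (momentum (M + 1) α k)
    positivity
  have hε1 : ∀ α : ℝ, ∀ k, 1 + (-1) * boltzmann J h β (momentum (M + 1) α k) ≠ 0 := fun α k => by
    have := hx (momentum (M + 1) α k)
    linarith
  set E : ℂ := Complex.exp (β * h * (M + 1 : ℕ) / 2) with hE
  have hE0 : E ≠ 0 := Complex.exp_ne_zero _
  have z10 := trace_exp_fermionHamiltonian (M := M) hα1 hζ1 J h β hs0
  have z11 := trace_exp_fermionHamiltonian (M := M) hα1 hζ1 J h β hs1
  have z00 := trace_exp_fermionHamiltonian (M := M) hα0 hζ0 J h β hs0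
  have z01 := trace_exp_fermionHamiltonian (M := M) hα0 hζ0 J h β hs1
  have n10 := trace_downNumber_mul_exp_fermionHamiltonian hα1 hζ1 J h β hs0 (hε0 (1 / 2))
  have n11 := trace_downNumber_mul_exp_fermionHamiltonian hα1 hζ1 J h β hs1 (hε1 (1 / 2))
  have n00 := trace_downNumber_mul_exp_fermionHamiltonian hα0 hζ0 J h β hs0 (hε0 0)
  have n01 := trace_downNumber_mul_exp_fermionHamiltonian hα0 hζ0 J h β hs1 (hε1 0)
  rw [zero_smul, add_zero] at z10 z00 n10 n00
  rw [← exp_fermionHamiltonian_mul_parity hα1 hζ1] at z11 n11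
  rw [← exp_fermionHamiltonian_mul_parity hα0 hζ0] at z01 n01
  rw [← hE] at z10 z11 z00 z01 n10 n11 n00 n01
  rw [finiteMagnetization, gibbsAverage, totalSpinZ_eq, exp_hamiltonianXY hM]
  simp only [sub_mul, mul_add, mul_sub, mul_one, mul_smul_comm, smul_mul_assoc, one_mul,
    Matrix.trace_add, Matrix.trace_sub, Matrix.trace_smul, smul_eq_mul,
    z10, z11, z00, z01, n10, n11, n00, n01]
  generalize modeProd J h β (M + 1) (1 / 2) 1 = a1, modeProd J h β (M + 1) (1 / 2) (-1) = a2,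
    modeProd J h β (M + 1) 0 1 = a3, modeProd J h β (M + 1) 0 (-1) = a4,
    modeSum J h β (M + 1) (1 / 2) 1 = r1, modeSum J h β (M + 1) (1 / 2) (-1) = r2,
    modeSum J h β (M + 1) 0 1 = r3, modeSum J h β (M + 1) 0 (-1) = r4 at hZ ⊢
  have hN : ((M + 1 : ℕ) : ℝ) ≠ 0 := Nat.cast_ne_zero.2 (Nat.succ_ne_zero M)
  have hZ' : (a1 + a2 + (a3 - a4) : ℂ) ≠ 0 := by exact_mod_cast hZ
  have hre : ∀ (z : ℂ) (r : ℝ), z = r → z.re / (M + 1 : ℕ) = r / (M + 1 : ℕ) :=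
    fun z r hzr => by rw [hzr, Complex.ofReal_re]
  rw [hre _ ((M + 1 : ℕ) / 2 - (a1 * r1 + a2 * r2 + (a3 * r3 - a4 * r4))
    / (a1 + a2 + (a3 - a4)))]
  · rw [sub_div, div_right_comm, div_self hN]
  · have hden : (1 / 2 * (E * a1) + 1 / 2 * (E * a2) + (1 / 2 * (E * a3) - 1 / 2 * (E * a4)) : ℂ)
        = E / 2 * (a1 + a2 + (a3 - a4)) := by ring
    rw [hden, div_eq_iff (mul_ne_zero (div_ne_zero hE0 two_ne_zero) hZ')]
    push_cast
    field_simp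
    ring

end FiniteSize

/-! ### The thermodynamic limit -/

section Limit

/-- Riemann sums with equally spaced nodes, at a fixed relative position in each cell. -/
theorem tendsto_riemann_sum {f : ℝ → ℝ} (hf : Continuous f) {α : ℝ} (h0 : 0 ≤ α) (h1 : α ≤ 1) :
    Tendsto (fun N : ℕ => (∑ k ∈ Finset.range N, f ((k + α) / N)) / N) atTop
      (𝓝 (∫ x in (0 : ℝ)..1, f x)) := by
  have huc := isCompact_Icc.uniformContinuousOn_of_continuous
    (hf.continuousOn (s := Set.Icc (0 : ℝ) 1))
  rw [Metric.uniformContinuousOn_iff] at huc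
  rw [Metric.tendsto_atTop]
  intro ε hε
  obtain ⟨δ, hδ, hfδ⟩ := huc (ε / 2) (half_pos hε)
  obtain ⟨n₀, hn₀⟩ := exists_nat_gt (1 / δ)
  refine ⟨max n₀ 1, fun N hN => ?_⟩
  have hN1 : 0 < N := (le_max_right n₀ 1).trans hN
  have hNpos : (0 : ℝ) < N := Nat.cast_pos.2 hN1
  have hNδ : 1 / (N : ℝ) < δ := by
    rw [one_div_lt hNpos hδ]
    exact hn₀.trans_le (Nat.cast_le.2 ((le_max_left n₀ 1).trans hN))
  have hsplit : ∫ x in (0 : ℝ)..1, f x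
      = ∑ k ∈ Finset.range N, ∫ x in ((k : ℝ) / N)..((k + 1 : ℕ) / N : ℝ), f x := by
    rw [intervalIntegral.sum_integral_adjacent_intervals (a := fun k : ℕ => (k : ℝ) / N)
      fun k _ => hf.intervalIntegrable _ _]
    simp [hNpos.ne']
  have hcell : ∀ k ∈ Finset.range N,
      |f ((k + α) / N) / N - ∫ x in ((k : ℝ) / N)..((k + 1 : ℕ) / N : ℝ), f x|
        ≤ ε / 2 * (1 / N) := by
    intro k hk
    have hk' : (k : ℝ) + 1 ≤ N := by exact_mod_cast Finset.mem_range.1 hk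
    have hk0 : (0 : ℝ) ≤ k := Nat.cast_nonneg k
    have hlen : ((k + 1 : ℕ) : ℝ) / N - k / N = 1 / N := by
      push_cast
      ring
    have hle : (k : ℝ) / N ≤ ((k + 1 : ℕ) : ℝ) / N := by
      push_cast
      gcongr
      linarith
    have hc : f ((k + α) / N) / N - ∫ x in ((k : ℝ) / N)..((k + 1 : ℕ) / N : ℝ), f x
        = ∫ x in ((k : ℝ) / N)..((k + 1 : ℕ) / N : ℝ), (f ((k + α) / N) - f x) := by
      rw [intervalIntegral.integral_sub (by simp) (hf.intervalIntegrable _ _),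
        intervalIntegral.integral_const, hlen, smul_eq_mul]
      ring
    rw [hc, ← Real.norm_eq_abs]
    refine (intervalIntegral.norm_integral_le_of_norm_le_const (C := ε / 2) fun x hx => ?_).trans ?_
    · rw [Set.uIoc_of_le hle] at hx
      have hx0 : 0 ≤ (k : ℝ) / N := by positivity
      have hx1 : ((k + 1 : ℕ) : ℝ) / N ≤ 1 := by
        rw [div_le_one hNpos]
        push_cast
        exact hk'
      have hy0 : (k : ℝ) / N ≤ (k + α) / N := by gcongr; linarith
      have hy1 : (k + α) / N ≤ ((k + 1 : ℕ) : ℝ) / N := by push_cast; gcongr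
      refine (hfδ _ ⟨hx0.trans hy0, hy1.trans hx1⟩ _ ⟨hx0.trans hx.1.le, hx.2.trans hx1⟩ ?_).le
      rw [Real.dist_eq, abs_lt]
      constructor <;> linarith [hx.1, hx.2]
    · rw [hlen, abs_of_pos (by positivity)]
  rw [hsplit, Real.dist_eq, Finset.sum_div, ← Finset.sum_sub_distrib]
  calc _ ≤ ∑ k ∈ Finset.range N, ε / 2 * (1 / (N : ℝ)) :=
        (Finset.abs_sum_le_sum_abs _ _).trans (Finset.sum_le_sum hcell)
    _ = ε / 2 := by
        rw [Finset.sum_const, Finset.card_range, nsmul_eq_mul]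
        field_simp
    _ < ε := half_lt_self hε

/-- A weighted average with two dominant weights `a`, `b` and two small ones of either sign. -/
theorem abs_average_sub_le {a b a' b' r₁ r₂ r₃ r₄ I ε q : ℝ} (ha : 0 < a) (hb : 0 < b)
    (ha' : 0 ≤ a') (haε : a' ≤ ε * a) (hb' : 0 ≤ b') (hbε : b' ≤ ε * b) (hε : ε ≤ q) (hq : q < 1) :
    0 < a + a' + (b - b') ∧
    |(a * r₁ + a' * r₂ + (b * r₃ - b' * r₄)) / (a + a' + (b - b')) - I|
      ≤ (|r₁ - I| + |r₃ - I| + ε * (|r₂ - I| + |r₄ - I|)) / (1 - q) := by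
  have hε0 : 0 ≤ ε := by
    by_contra! h
    nlinarith
  have hq' : 0 < 1 - q := sub_pos.2 hq
  have hZ : (a + b) * (1 - q) ≤ a + a' + (b - b') := by nlinarith
  have hZ0 : 0 < (a + b) * (1 - q) := by positivity
  have hZ1 := hZ0.trans_le hZ
  refine ⟨hZ1, ?_⟩
  have h1 : (a * r₁ + a' * r₂ + (b * r₃ - b' * r₄)) / (a + a' + (b - b')) - I
      = (a * (r₁ - I) + a' * (r₂ - I) + b * (r₃ - I) - b' * (r₄ - I))
        / (a + a' + (b - b')) := by
    field_simp
    ring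
  have h2 : |a * (r₁ - I) + a' * (r₂ - I) + b * (r₃ - I) - b' * (r₄ - I)|
      ≤ (a + b) * (|r₁ - I| + |r₃ - I| + ε * (|r₂ - I| + |r₄ - I|)) := by
    have e1 : |a * (r₁ - I)| ≤ (a + b) * |r₁ - I| := by
      rw [abs_mul, abs_of_pos ha]
      gcongr
      linarith
    have e2 : |a' * (r₂ - I)| ≤ (a + b) * (ε * |r₂ - I|) := by
      rw [abs_mul, abs_of_nonneg ha', ← mul_assoc]
      gcongr
      nlinarith
    have e3 : |b * (r₃ - I)| ≤ (a + b) * |r₃ - I| := by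
      rw [abs_mul, abs_of_pos hb]
      gcongr
      linarith
    have e4 : |b' * (r₄ - I)| ≤ (a + b) * (ε * |r₄ - I|) := by
      rw [abs_mul, abs_of_nonneg hb', ← mul_assoc]
      gcongr
      nlinarith
    have t1 := abs_sub (a * (r₁ - I) + a' * (r₂ - I) + b * (r₃ - I)) (b' * (r₄ - I))
    have t2 := abs_add_le (a * (r₁ - I) + a' * (r₂ - I)) (b * (r₃ - I))
    have t3 := abs_add_le (a * (r₁ - I)) (a' * (r₂ - I))
    linarith
  rw [h1, abs_div, abs_of_pos hZ1, div_le_div_iff₀ hZ1 hq']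
  refine (mul_le_mul_of_nonneg_right h2 hq'.le).trans ?_
  rw [mul_comm (a + b), mul_assoc]
  gcongr

variable {J h β : ℝ}

theorem modeProd_one_pos (N : ℕ) (α : ℝ) : 0 < modeProd J h β N α 1 :=
  Finset.prod_pos fun k _ => by
    have := boltzmann_pos J h β (momentum N α k)
    positivity

theorem modeProd_neg_one_nonneg (hJ : 0 < J) (hh : J < h) (hβ : 0 < β) (N : ℕ) (α : ℝ) :
    0 ≤ modeProd J h β N α (-1) :=
  Finset.prod_nonneg fun k _ => by
    linarith [boltzmann_le (h := h) hJ hβ (momentum N α k), exp_gap_lt_one hh hβ]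

/-- The parity-weighted partition function is exponentially small in the size of the system
compared with the partition function. -/
theorem modeProd_neg_one_le (hJ : 0 < J) (hh : J < h) (hβ : 0 < β) (N : ℕ) (α : ℝ) :
    modeProd J h β N α (-1)
      ≤ (1 / (1 + Real.exp (-(β * (h + J))))) ^ N * modeProd J h β N α 1 := by
  have hx0 := Real.exp_pos (-(β * (h + J)))
  rw [modeProd, modeProd, ← Finset.card_range N, ← Finset.prod_const, Finset.card_range,
    ← Finset.prod_mul_distrib]
  refine Finset.prod_le_prod (fun k _ => ?_) fun k _ => ?_
  · linarith [boltzmann_le (h := h) hJ hβ (momentum N α k), exp_gap_lt_one hh hβ]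
  · have h1 := le_boltzmann (h := h) hJ hβ (momentum N α k)
    have h2 := (boltzmann_le (h := h) hJ hβ (momentum N α k)).trans_lt (exp_gap_lt_one hh hβ)
    rw [one_div_mul_eq_div, le_div_iff₀ (by positivity)]
    nlinarith

theorem abs_modeSum_neg_one_div_le (hJ : 0 < J) (hh : J < h) (hβ : 0 < β) {N : ℕ} (hN : N ≠ 0)
    (α : ℝ) : |modeSum J h β N α (-1) / N| ≤ 1 / (1 - Real.exp (-(β * (h - J)))) := by
  have he := exp_gap_lt_one hh hβ
  have hN' : (0 : ℝ) < N := Nat.cast_pos.2 (Nat.pos_of_ne_zero hN)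
  rw [abs_div, abs_of_pos hN', div_le_iff₀ hN', modeSum]
  refine (Finset.abs_sum_le_sum_abs _ _).trans ?_
  calc _ ≤ ∑ k ∈ Finset.range N, 1 / (1 - Real.exp (-(β * (h - J)))) := by
        refine Finset.sum_le_sum fun k _ => ?_
        have h0 := boltzmann_pos J h β (momentum N α k)
        have h1 := boltzmann_le (h := h) hJ hβ (momentum N α k)
        rw [abs_div, neg_one_mul, abs_neg, abs_of_pos h0, ← sub_eq_add_neg,
          abs_of_pos (by linarith)]
        gcongr
        linarith
    _ = _ := by rw [Finset.sum_const, Finset.card_range, nsmul_eq_mul, mul_comm]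

theorem continuous_boltzmann : Continuous (boltzmann J h β) := by
  unfold boltzmann
  fun_prop

/-- The density of down spins in the infinite chain: the average of the Fermi function
`x / (1 + x)` of the Boltzmann factor over the momenta `2π x`. -/
def downDensity (J h β : ℝ) : ℝ :=
  ∫ x in (0 : ℝ)..1,
    boltzmann J h β (2 * Real.pi * x) / (1 + boltzmann J h β (2 * Real.pi * x))

theorem tendsto_modeSum_one_div {α : ℝ} (h0 : 0 ≤ α) (h1 : α ≤ 1) :
    Tendsto (fun N : ℕ => modeSum J h β N α 1 / N) atTop (𝓝 (downDensity J h β)) := by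
  have hc : Continuous fun x : ℝ =>
      boltzmann J h β (2 * Real.pi * x) / (1 + boltzmann J h β (2 * Real.pi * x)) := by
    have := continuous_boltzmann (J := J) (h := h) (β := β)
    refine Continuous.div (by fun_prop) (by fun_prop) fun x => ?_
    have := boltzmann_pos J h β (2 * Real.pi * x)
    positivity
  refine (tendsto_riemann_sum hc h0 h1).congr fun N => ?_
  simp only [modeSum, momentum, one_mul]

theorem tendsto_finiteMagnetization (hJ : 0 < J) (hh : J < h) (hβ : 0 < β) :
    Tendsto (finiteMagnetization J h β) atTop (𝓝 (1 / 2 - downDensity J h β)) := by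
  set q : ℝ := 1 / (1 + Real.exp (-(β * (h + J)))) with hq
  set C : ℝ := 1 / (1 - Real.exp (-(β * (h - J)))) with hC
  have hx0 := Real.exp_pos (-(β * (h + J)))
  have hq0 : 0 < q := by positivity
  have hq1 : q < 1 := by
    rw [hq, div_lt_one (by positivity)]
    linarith
  set I := downDensity J h β with hI
  have hR1 : Tendsto (fun N : ℕ => |modeSum J h β N (1 / 2) 1 / N - I|) atTop (𝓝 0) := by
    have := (tendsto_modeSum_one_div (J := J) (h := h) (β := β) (α := 1 / 2)
      (by norm_num) (by norm_num)).sub_const I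
    simpa [hI] using this.abs
  have hR2 : Tendsto (fun N : ℕ => |modeSum J h β N 0 1 / N - I|) atTop (𝓝 0) := by
    have := (tendsto_modeSum_one_div (J := J) (h := h) (β := β) (α := 0)
      le_rfl zero_le_one).sub_const I
    simpa [hI] using this.abs
  have hpow := tendsto_pow_atTop_nhds_zero_of_lt_one hq0.le hq1
  have hbound : Tendsto (fun N : ℕ => (|modeSum J h β N (1 / 2) 1 / N - I|
      + |modeSum J h β N 0 1 / N - I| + q ^ N * ((C + |I|) + (C + |I|))) / (1 - q))
      atTop (𝓝 0) := by
    have := ((hR1.add hR2).add (hpow.mul_const ((C + |I|) + (C + |I|)))).div_const (1 - q)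
    simpa using this
  have hzero : Tendsto (fun N => finiteMagnetization J h β N - (1 / 2 - I)) atTop (𝓝 0) := by
    refine squeeze_zero_norm' ?_ hbound
    -- for `N = 1` the bond that closes the ring joins the site to itself
    filter_upwards [eventually_ge_atTop 2] with N hN
    obtain ⟨M, rfl⟩ : ∃ M, N = M + 1 := ⟨N - 1, by omega⟩
    have hM : M ≠ 0 := by omega
    have hN0 : M + 1 ≠ 0 := Nat.succ_ne_zero M
    have hN' : ((M + 1 : ℕ) : ℝ) ≠ 0 := Nat.cast_ne_zero.2 hN0
    have hqN : q ^ (M + 1) ≤ q := pow_le_of_le_one hq0.le hq1.le hN0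
    obtain ⟨hZ, hav⟩ := abs_average_sub_le (I := I)
      (r₁ := modeSum J h β (M + 1) (1 / 2) 1 / (M + 1 : ℕ))
      (r₂ := modeSum J h β (M + 1) (1 / 2) (-1) / (M + 1 : ℕ))
      (r₃ := modeSum J h β (M + 1) 0 1 / (M + 1 : ℕ))
      (r₄ := modeSum J h β (M + 1) 0 (-1) / (M + 1 : ℕ))
      (modeProd_one_pos (J := J) (h := h) (β := β) (M + 1) (1 / 2))
      (modeProd_one_pos (J := J) (h := h) (β := β) (M + 1) 0)
      (modeProd_neg_one_nonneg hJ hh hβ (M + 1) (1 / 2))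
      (modeProd_neg_one_le hJ hh hβ (M + 1) (1 / 2))
      (modeProd_neg_one_nonneg hJ hh hβ (M + 1) 0)
      (modeProd_neg_one_le hJ hh hβ (M + 1) 0) hqN hq1
    rw [finiteMagnetization_eq hJ hh hβ hM hZ.ne', Real.norm_eq_abs, sub_sub_sub_cancel_left,
      abs_sub_comm]
    have hr : ∀ α, |modeSum J h β (M + 1) α (-1) / (M + 1 : ℕ) - I| ≤ C + |I| := fun α =>
      (abs_sub _ _).trans (add_le_add_left (abs_modeSum_neg_one_div_le hJ hh hβ hN0 α) _)
    refine le_trans (le_of_eq ?_) (hav.trans ?_)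
    · congr 2
      simp only [mul_div_assoc']
      rw [div_right_comm, ← add_div, ← sub_div, ← add_div]
    · have := sub_pos.2 hq1
      gcongr
      · exact hr _
      · exact hr _
  have := hzero.add_const (1 / 2 - I)
  simpa using this

end Limit

/-! ### The Laplace-type integral `∫ exp (-2 y sin² θ) dθ` -/

section Laplace

open MeasureTheory

/-- The Taylor coefficients `(2n-1)!! / (n! 2ⁿ)` of `(1 - x)^{-1/2}`. -/
def invSqrtCoeff (n : ℕ) : ℝ := ((2 * n - 1).doubleFactorial : ℝ) / (n.factorial * 2 ^ n)

theorem doubleFactorial_succ (n : ℕ) :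
    (2 * (n + 1) - 1).doubleFactorial = (2 * n + 1) * (2 * n - 1).doubleFactorial := by
  rcases n with _ | n
  · rfl
  · exact Nat.doubleFactorial_add_two (2 * n + 1)

theorem invSqrtCoeff_nonneg (n : ℕ) : 0 ≤ invSqrtCoeff n := by
  unfold invSqrtCoeff
  positivity

theorem invSqrtCoeff_succ (n : ℕ) :
    (2 * n + 2) * invSqrtCoeff (n + 1) = (2 * n + 1) * invSqrtCoeff n := by
  unfold invSqrtCoeff
  rw [doubleFactorial_succ, Nat.factorial_succ]
  push_cast
  field_simp
  ring

/-- The remainder of `1 = cos θ (1 - sin² θ)^{-1/2}` after the terms of order `≤ 2m` in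
`sin θ`. -/
def invSqrtRemainder (m : ℕ) (θ : ℝ) : ℝ :=
  1 - ∑ n ∈ Finset.range (m + 1), invSqrtCoeff n * (Real.cos θ * Real.sin θ ^ (2 * n))

/-- The derivative of the remainder telescopes to a single power of `sin θ`. -/
theorem hasDerivAt_invSqrtRemainder (m : ℕ) (θ : ℝ) :
    HasDerivAt (invSqrtRemainder m)
      ((2 * m + 1) * invSqrtCoeff m * Real.sin θ ^ (2 * m + 1)) θ := by
  induction m with
  | zero =>
    have h : invSqrtRemainder 0 = fun θ => 1 - Real.cos θ := by
      funext θ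
      simp [invSqrtRemainder, invSqrtCoeff]
    rw [h]
    refine ((Real.hasDerivAt_cos θ).const_sub 1).congr_deriv ?_
    simp [invSqrtCoeff]
  | succ m ih =>
    have h : invSqrtRemainder (m + 1) = fun θ => invSqrtRemainder m θ
        - invSqrtCoeff (m + 1) * (Real.cos θ * Real.sin θ ^ (2 * m + 2)) := by
      funext θ
      rw [invSqrtRemainder, Finset.sum_range_succ, invSqrtRemainder, mul_add_one]
      ring
    rw [h]
    refine (ih.sub (((Real.hasDerivAt_cos θ).mul
      ((Real.hasDerivAt_sin θ).pow (2 * m + 2))).const_mul (invSqrtCoeff (m + 1)))).congr_deriv ?_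
    have hc := invSqrtCoeff_succ m
    have hcs : Real.cos θ * Real.cos θ = 1 - Real.sin θ ^ 2 := by
      rw [← sq, Real.cos_sq']
    have e : 2 * m + 2 - 1 = 2 * m + 1 := rfl
    rw [e, Pi.pow_apply]
    push_cast
    linear_combination -Real.sin θ ^ (2 * m + 1) * hc - (2 * m + 2) * invSqrtCoeff (m + 1)
      * Real.sin θ ^ (2 * m + 1) * hcs

theorem invSqrtRemainder_zero (m : ℕ) : invSqrtRemainder m 0 = 0 := by
  rw [invSqrtRemainder, Finset.sum_range_succ']
  simp [invSqrtCoeff]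

theorem continuous_invSqrtRemainder (m : ℕ) : Continuous (invSqrtRemainder m) := by
  unfold invSqrtRemainder
  fun_prop

theorem abs_invSqrtRemainder_le (m : ℕ) {θ : ℝ} (h0 : 0 ≤ θ) :
    |invSqrtRemainder m θ| ≤ (2 * m + 1) * invSqrtCoeff m * θ ^ (2 * m + 2) := by
  have hb := invSqrtCoeff_nonneg m
  have h := norm_image_sub_le_of_norm_deriv_le_segment' (f := invSqrtRemainder m)
    (f' := fun θ => (2 * m + 1) * invSqrtCoeff m * Real.sin θ ^ (2 * m + 1)) (a := 0) (b := θ)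
    (C := (2 * m + 1) * invSqrtCoeff m * θ ^ (2 * m + 1))
    (fun x _ => (hasDerivAt_invSqrtRemainder m x).hasDerivWithinAt)
    (fun x hx => by
      rw [Real.norm_eq_abs, abs_mul, abs_pow, abs_of_nonneg (by positivity)]
      gcongr
      exact (Real.abs_sin_le_abs).trans ((abs_of_nonneg hx.1).le.trans hx.2.le)) θ
    ⟨h0, le_rfl⟩
  rw [invSqrtRemainder_zero, sub_zero, sub_zero, Real.norm_eq_abs, mul_assoc, ← pow_succ] at h
  exact h

theorem integrableOn_pow_mul_gaussian (n : ℕ) {b : ℝ} (hb : 0 < b) :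
    IntegrableOn (fun u : ℝ => u ^ (2 * n) * Real.exp (-b * u ^ 2)) (Set.Ioi 0) := by
  have h := integrableOn_rpow_mul_exp_neg_mul_sq hb (s := (2 * n : ℕ))
    (by linarith [Nat.cast_nonneg (α := ℝ) (2 * n)])
  simpa only [Real.rpow_natCast] using h

theorem integral_pow_mul_gaussian (n : ℕ) {b : ℝ} (hb : 0 < b) :
    ∫ u in Set.Ioi (0 : ℝ), u ^ (2 * n) * Real.exp (-b * u ^ 2)
      = b ^ (-((n : ℝ) + 1 / 2)) * (1 / 2) * Real.Gamma (n + 1 / 2) := by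
  have h := integral_rpow_mul_exp_neg_mul_rpow (p := 2) (q := (2 * n : ℕ)) (b := b) two_pos
    (by linarith [Nat.cast_nonneg (α := ℝ) (2 * n)]) hb
  have e : (((2 * n : ℕ) : ℝ) + 1) / 2 = n + 1 / 2 := by
    push_cast
    ring
  rw [neg_div, e] at h
  rw [← h]
  refine setIntegral_congr_fun measurableSet_Ioi fun u _ => ?_
  simp only [Real.rpow_natCast, Real.rpow_two]

/-- `(2 / π) ∫ exp (-2 y sin² θ) dθ` over a quarter period.  This is `e^{-y} I₀(y)`, with the
modified Bessel function `I₀`. -/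
def scaledBessel (y : ℝ) : ℝ :=
  2 / Real.pi * ∫ θ in (0 : ℝ)..Real.pi / 2, Real.exp (-(2 * y) * Real.sin θ ^ 2)

/-- The coefficients of the large-argument expansion of `scaledBessel`. -/
def besselCoeff (n : ℕ) : ℝ :=
  ((2 * n - 1).doubleFactorial : ℝ) ^ 2 / (n.factorial * 8 ^ n * √(2 * Real.pi))

theorem besselCoeff_pos (n : ℕ) : 0 < besselCoeff n := by
  have : 0 < (2 * n - 1).doubleFactorial := Nat.doubleFactorial_pos _
  unfold besselCoeff
  positivity

theorem coeff_mul_gaussian (n : ℕ) {y : ℝ} (hy : 0 < y) :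
    2 / Real.pi * (invSqrtCoeff n
      * ∫ u in Set.Ioi (0 : ℝ), u ^ (2 * n) * Real.exp (-(2 * y) * u ^ 2))
      = besselCoeff n * y ^ (-((n : ℝ) + 1 / 2)) := by
  rw [integral_pow_mul_gaussian n (by positivity), Real.mul_rpow two_pos.le hy.le,
    Real.Gamma_nat_add_half, invSqrtCoeff, besselCoeff, Real.rpow_neg two_pos.le,
    Real.rpow_add two_pos, Real.rpow_natCast, ← Real.sqrt_eq_rpow,
    Real.sqrt_mul two_pos.le]
  have hpi : Real.pi = √Real.pi * √Real.pi := (Real.mul_self_sqrt Real.pi_pos.le).symm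
  have h8 : (8 : ℝ) ^ n = 2 ^ n * 2 ^ n * 2 ^ n := by
    rw [← mul_pow, ← mul_pow]
    norm_num
  have h0 : √Real.pi ≠ 0 := (Real.sqrt_pos.2 Real.pi_pos).ne'
  rw [h8]
  nth_rewrite 1 [hpi]
  field_simp

/-- Substituting `u = sin θ` turns a term of the expansion into a Gaussian moment, up to a tail
that is smaller than every later term. -/
theorem abs_term_sub_gaussian_le {n k : ℕ} (hnk : n ≤ k) {y : ℝ} (hy : 0 < y) :
    |(∫ θ in (0 : ℝ)..Real.pi / 2, Real.cos θ * Real.sin θ ^ (2 * n)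
        * Real.exp (-(2 * y) * Real.sin θ ^ 2))
      - ∫ u in Set.Ioi (0 : ℝ), u ^ (2 * n) * Real.exp (-(2 * y) * u ^ 2)|
      ≤ ∫ u in Set.Ioi (0 : ℝ), u ^ (2 * k) * Real.exp (-(2 * y) * u ^ 2) := by
  have h2y : 0 < 2 * y := by positivity
  have hsub : (∫ θ in (0 : ℝ)..Real.pi / 2, Real.cos θ * Real.sin θ ^ (2 * n)
        * Real.exp (-(2 * y) * Real.sin θ ^ 2))
      = ∫ u in (0 : ℝ)..1, u ^ (2 * n) * Real.exp (-(2 * y) * u ^ 2) := by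
    have h := intervalIntegral.integral_comp_mul_deriv (a := 0) (b := Real.pi / 2)
      (f := Real.sin) (f' := Real.cos)
      (g := fun u : ℝ => u ^ (2 * n) * Real.exp (-(2 * y) * u ^ 2))
      (fun x _ => Real.hasDerivAt_sin x) Real.continuous_cos.continuousOn (by fun_prop)
    rw [Real.sin_zero, Real.sin_pi_div_two] at h
    rw [← h]
    refine intervalIntegral.integral_congr fun θ _ => ?_
    simp only [Function.comp_apply]
    ring
  have hin := integrableOn_pow_mul_gaussian n h2y
  have hik := integrableOn_pow_mul_gaussian k h2y
  -- the tail over `u ≥ 1`, where `u ^ (2 * n) ≤ u ^ (2 * k)`, is the whole difference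
  have hsplit : ∫ u in Set.Ioi (0 : ℝ), u ^ (2 * n) * Real.exp (-(2 * y) * u ^ 2)
      = (∫ u in (0 : ℝ)..1, u ^ (2 * n) * Real.exp (-(2 * y) * u ^ 2))
        + ∫ u in Set.Ioi (1 : ℝ), u ^ (2 * n) * Real.exp (-(2 * y) * u ^ 2) := by
    rw [intervalIntegral.integral_of_le zero_le_one, ← setIntegral_union
      (Set.Ioc_disjoint_Ioi le_rfl) measurableSet_Ioi (hin.mono_set Set.Ioc_subset_Ioi_self)
      (hin.mono_set (Set.Ioi_subset_Ioi zero_le_one)), Set.Ioc_union_Ioi_eq_Ioi zero_le_one]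
  rw [hsub, hsplit, sub_add_cancel_left, abs_neg, abs_of_nonneg]
  · calc _ ≤ ∫ u in Set.Ioi (1 : ℝ), u ^ (2 * k) * Real.exp (-(2 * y) * u ^ 2) := by
          refine setIntegral_mono_on (hin.mono_set (Set.Ioi_subset_Ioi zero_le_one))
            (hik.mono_set (Set.Ioi_subset_Ioi zero_le_one)) measurableSet_Ioi fun u hu => ?_
          have hu' : 1 ≤ u := (Set.mem_Ioi.1 hu).le
          gcongr
      _ ≤ _ := by
          refine setIntegral_mono_set hik ?_ (Set.Ioi_subset_Ioi zero_le_one).eventuallyLE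
          exact Eventually.of_forall fun u => by
            simp only [Pi.zero_apply]
            rw [pow_mul]
            positivity
  · refine setIntegral_nonneg measurableSet_Ioi fun u _ => ?_
    rw [pow_mul]
    positivity

/-- Jordan's inequality `2 θ / π ≤ sin θ` bounds the remainder by a Gaussian moment. -/
theorem abs_integral_remainder_le (m : ℕ) {y : ℝ} (hy : 0 < y) :
    |∫ θ in (0 : ℝ)..Real.pi / 2, invSqrtRemainder m θ * Real.exp (-(2 * y) * Real.sin θ ^ 2)|
      ≤ (2 * m + 1) * invSqrtCoeff m * ∫ u in Set.Ioi (0 : ℝ), u ^ (2 * (m + 1))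
        * Real.exp (-(2 * y * (2 / Real.pi) ^ 2) * u ^ 2) := by
  have hpi := Real.pi_pos
  have hb := invSqrtCoeff_nonneg m
  have hi := integrableOn_pow_mul_gaussian (m + 1) (b := 2 * y * (2 / Real.pi) ^ 2) (by positivity)
  rw [← Real.norm_eq_abs, ← integral_const_mul]
  refine (intervalIntegral.norm_integral_le_of_norm_le (by positivity)
    (g := fun u => (2 * m + 1) * invSqrtCoeff m * (u ^ (2 * (m + 1))
        * Real.exp (-(2 * y * (2 / Real.pi) ^ 2) * u ^ 2))) ?_
    (Continuous.intervalIntegrable (by fun_prop) _ _)).trans ?_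
  · refine Eventually.of_forall fun θ hθ => ?_
    have h0 : 0 ≤ θ := hθ.1.le
    rw [Real.norm_eq_abs, abs_mul, Real.abs_exp, ← mul_assoc]
    refine mul_le_mul (abs_invSqrtRemainder_le m h0) ?_ (Real.exp_pos _).le (by positivity)
    rw [Real.exp_le_exp, neg_mul, neg_mul, neg_le_neg_iff, mul_assoc, ← mul_pow]
    gcongr
    exact Real.mul_le_sin h0 hθ.2
  · rw [intervalIntegral.integral_of_le (by positivity)]
    refine setIntegral_mono_set (hi.const_mul _) ?_ Set.Ioc_subset_Ioi_self.eventuallyLE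
    exact Eventually.of_forall fun u => by
      simp only [Pi.zero_apply]
      rw [pow_mul]
      positivity

/-- The expansion of `scaledBessel` with a remainder of the order of the first omitted term,
uniformly over all positive arguments. -/
theorem exists_abs_scaledBessel_sub_le (m : ℕ) : ∃ C : ℝ, 0 ≤ C ∧ ∀ y : ℝ, 0 < y →
    |scaledBessel y - ∑ n ∈ Finset.range (m + 1), besselCoeff n * y ^ (-((n : ℝ) + 1 / 2))|
      ≤ C * y ^ (-(((m + 1 : ℕ) : ℝ) + 1 / 2)) := by
  have hpi := Real.pi_pos
  have hb := invSqrtCoeff_nonneg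
  set p : ℝ := -(((m + 1 : ℕ) : ℝ) + 1 / 2) with hp
  set Γ : ℝ := 1 / 2 * Real.Gamma ((m + 1 : ℕ) + 1 / 2) with hΓ
  have hΓ0 : 0 ≤ Γ := by
    have := Real.Gamma_pos_of_pos (show (0 : ℝ) < (m + 1 : ℕ) + 1 / 2 by positivity)
    positivity
  refine ⟨2 / Real.pi * ((2 * m + 1) * invSqrtCoeff m * ((2 * (2 / Real.pi) ^ 2) ^ p * Γ)
    + ∑ n ∈ Finset.range (m + 1), invSqrtCoeff n * (2 ^ p * Γ)), ?_, fun y hy => ?_⟩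
  · have : 0 ≤ ∑ n ∈ Finset.range (m + 1), invSqrtCoeff n * ((2 : ℝ) ^ p * Γ) :=
      Finset.sum_nonneg fun n _ => mul_nonneg (hb n) (by positivity)
    have := hb m
    positivity
  set G : ℝ → ℝ := fun θ => Real.exp (-(2 * y) * Real.sin θ ^ 2) with hG
  have hGc : Continuous G := by fun_prop
  have hsplit : ∫ θ in (0 : ℝ)..Real.pi / 2, G θ
      = (∫ θ in (0 : ℝ)..Real.pi / 2, invSqrtRemainder m θ * G θ)
        + ∑ n ∈ Finset.range (m + 1), invSqrtCoeff n
          * ∫ θ in (0 : ℝ)..Real.pi / 2, Real.cos θ * Real.sin θ ^ (2 * n) * G θ := by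
    have hR := continuous_invSqrtRemainder m
    simp only [← intervalIntegral.integral_const_mul]
    rw [← intervalIntegral.integral_finsetSum fun n _ =>
      Continuous.intervalIntegrable (by fun_prop) _ _, ← intervalIntegral.integral_add
        (Continuous.intervalIntegrable (by fun_prop) _ _)
        (Continuous.intervalIntegrable (by fun_prop) _ _)]
    refine intervalIntegral.integral_congr fun θ _ => ?_
    simp only [invSqrtRemainder, sub_mul, one_mul, Finset.sum_mul, mul_assoc, sub_add_cancel]
  have hmain : scaledBessel y
      - ∑ n ∈ Finset.range (m + 1), besselCoeff n * y ^ (-((n : ℝ) + 1 / 2))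
      = 2 / Real.pi * ((∫ θ in (0 : ℝ)..Real.pi / 2, invSqrtRemainder m θ * G θ)
        + ∑ n ∈ Finset.range (m + 1), invSqrtCoeff n
          * ((∫ θ in (0 : ℝ)..Real.pi / 2, Real.cos θ * Real.sin θ ^ (2 * n) * G θ)
            - ∫ u in Set.Ioi (0 : ℝ), u ^ (2 * n) * Real.exp (-(2 * y) * u ^ 2))) := by
    rw [scaledBessel, hsplit]
    simp only [← coeff_mul_gaussian _ hy, mul_sub, Finset.sum_sub_distrib, mul_add,
      Finset.mul_sum]
    ring
  have hmom : ∀ c : ℝ, 0 < c → ∫ u in Set.Ioi (0 : ℝ), u ^ (2 * (m + 1))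
      * Real.exp (-(c * y) * u ^ 2) = c ^ p * Γ * y ^ p := fun c hc => by
    rw [integral_pow_mul_gaussian (m + 1) (by positivity), Real.mul_rpow hc.le hy.le]
    ring
  have h1 := abs_integral_remainder_le m hy
  rw [mul_right_comm 2 y, hmom _ (by positivity)] at h1
  have h2 : ∀ n ∈ Finset.range (m + 1), |invSqrtCoeff n
      * ((∫ θ in (0 : ℝ)..Real.pi / 2, Real.cos θ * Real.sin θ ^ (2 * n) * G θ)
        - ∫ u in Set.Ioi (0 : ℝ), u ^ (2 * n) * Real.exp (-(2 * y) * u ^ 2))|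
      ≤ invSqrtCoeff n * (2 ^ p * Γ * y ^ p) := fun n hn => by
    rw [abs_mul, abs_of_nonneg (hb n), ← hmom 2 two_pos]
    exact mul_le_mul_of_nonneg_left
      (abs_term_sub_gaussian_le (Finset.mem_range.1 hn).le hy) (hb n)
  rw [hmain, abs_mul, abs_of_pos (by positivity), mul_assoc, add_mul, Finset.sum_mul]
  refine mul_le_mul_of_nonneg_left ((abs_add_le _ _).trans (add_le_add ?_ ?_)) (by positivity)
  · rw [mul_assoc _ _ (y ^ p)]
    exact h1
  · refine (Finset.abs_sum_le_sum_abs _ _).trans (Finset.sum_le_sum fun n hn => ?_)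
    rw [mul_assoc _ _ (y ^ p)]
    exact h2 n hn

end Laplace

/-! ### The low-temperature expansion -/

section Expansion

variable {J h β : ℝ}

theorem boltzmann_two_mul (J h β t : ℝ) :
    boltzmann J h β (2 * t)
      = Real.exp (-(β * (h - J))) * Real.exp (-(2 * (β * J)) * Real.sin t ^ 2) := by
  rw [boltzmann, Real.cos_two_mul', Real.cos_sq', ← Real.exp_add]
  ring_nf

theorem downDensity_eq (J h β : ℝ) :
    downDensity J h β = 2 / Real.pi * ∫ θ in (0 : ℝ)..Real.pi / 2,
      boltzmann J h β (2 * θ) / (1 + boltzmann J h β (2 * θ)) := by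
  set g : ℝ → ℝ := fun θ => boltzmann J h β (2 * θ) / (1 + boltzmann J h β (2 * θ)) with hg
  have hgc : Continuous g := by
    have := continuous_boltzmann (J := J) (h := h) (β := β)
    refine Continuous.div (by fun_prop) (by fun_prop) fun x => ?_
    have := boltzmann_pos J h β (2 * x)
    positivity
  have h1 : downDensity J h β = ∫ x in (0 : ℝ)..1, g (Real.pi * x) := by
    simp only [downDensity, hg, mul_assoc]
  -- the integrand is symmetric under `θ ↦ π - θ`
  have h2 : ∫ x in (Real.pi / 2)..Real.pi, g x = ∫ x in (0 : ℝ)..Real.pi / 2, g x := by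
    have h3 := intervalIntegral.integral_comp_sub_left (a := 0) (b := Real.pi / 2) g Real.pi
    rw [sub_zero, sub_half] at h3
    rw [← h3]
    refine intervalIntegral.integral_congr fun x _ => ?_
    simp only [hg, boltzmann_two_mul, Real.sin_pi_sub]
  rw [h1, intervalIntegral.integral_comp_mul_left _ Real.pi_ne_zero, mul_zero, mul_one,
    ← intervalIntegral.integral_add_adjacent_intervals (b := Real.pi / 2)
      (hgc.intervalIntegrable _ _) (hgc.intervalIntegrable _ _), h2, smul_eq_mul]
  ring

/-- Expanding the Fermi function in a geometric series. -/
theorem hasSum_downDensity (hJ : 0 < J) (hh : J < h) (hβ : 0 < β) :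
    HasSum (fun l : ℕ => (-Real.exp (-(β * (h - J)))) ^ (l + 1)
      * scaledBessel ((l + 1) * (β * J))) (-downDensity J h β) := by
  set z := Real.exp (-(β * (h - J))) with hz
  have hz0 : 0 < z := Real.exp_pos _
  have hz1 : z < 1 := exp_gap_lt_one hh hβ
  have hsum : HasSum (fun l : ℕ => ∫ θ in (0 : ℝ)..Real.pi / 2,
      (-boltzmann J h β (2 * θ)) ^ (l + 1)) (∫ θ in (0 : ℝ)..Real.pi / 2,
        -(boltzmann J h β (2 * θ) / (1 + boltzmann J h β (2 * θ)))) := by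
    have hgeom : Summable fun l : ℕ => z ^ (l + 1) :=
      (summable_nat_add_iff 1).2 (summable_geometric_of_lt_one hz0.le hz1)
    refine intervalIntegral.hasSum_integral_of_dominated_convergence
      (fun l _ => z ^ (l + 1)) (fun l => ?_) (fun l => ?_) ?_ ?_ ?_
    · have := continuous_boltzmann (J := J) (h := h) (β := β)
      exact Continuous.aestronglyMeasurable (by fun_prop)
    · refine Eventually.of_forall fun θ _ => ?_
      rw [norm_pow, norm_neg, Real.norm_eq_abs, abs_of_pos (boltzmann_pos _ _ _ _)]
      exact pow_le_pow_left₀ (boltzmann_pos _ _ _ _).le (boltzmann_le hJ hβ _) _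
    · exact Eventually.of_forall fun _ _ => hgeom
    · exact intervalIntegrable_const
    · refine Eventually.of_forall fun θ _ => ?_
      have hb0 := boltzmann_pos J h β (2 * θ)
      have hb1 : boltzmann J h β (2 * θ) < 1 := (boltzmann_le hJ hβ _).trans_lt hz1
      have h1 := (hasSum_geometric_of_abs_lt_one (r := -boltzmann J h β (2 * θ))
        (by rwa [abs_neg, abs_of_pos hb0])).mul_left (-boltzmann J h β (2 * θ))
      rw [sub_neg_eq_add, ← div_eq_mul_inv, neg_div] at h1
      simpa only [pow_succ'] using h1
  have h2 := hsum.mul_left (2 / Real.pi)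
  rw [intervalIntegral.integral_neg, mul_neg, ← downDensity_eq] at h2
  refine h2.congr_fun fun l => ?_
  rw [scaledBessel, mul_left_comm, ← intervalIntegral.integral_const_mul]
  congr 1
  refine intervalIntegral.integral_congr fun θ _ => ?_
  simp only [boltzmann_two_mul]
  rw [← hz, neg_mul_eq_neg_mul z, mul_pow, ← Real.exp_nat_mul]
  push_cast
  ring_nf

/-- The terms of the expansion are sums of those of the expansion of `scaledBessel`. -/
theorem hasSum_expansionTerm (hJ : 0 < J) (hh : J < h) (hβ : 0 < β) (n : ℕ) :
    HasSum (fun l : ℕ => (-Real.exp (-(β * (h - J)))) ^ (l + 1)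
      * (besselCoeff n * ((l + 1) * (β * J)) ^ (-((n : ℝ) + 1 / 2)))) (expansionTerm J h n β) := by
  set z := Real.exp (-(β * (h - J))) with hz
  have hz0 : 0 < z := Real.exp_pos _
  have hz1 : z < 1 := exp_gap_lt_one hh hβ
  have hgeom : Summable fun l : ℕ => z ^ (l + 1) :=
    (summable_nat_add_iff 1).2 (summable_geometric_of_lt_one hz0.le hz1)
  have hs : Summable fun l : ℕ => (-z) ^ (l + 1) / ((l : ℝ) + 1) ^ ((n : ℝ) + 1 / 2) := by
    refine hgeom.of_norm_bounded fun l => ?_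
    have hl : (1 : ℝ) ≤ ((l : ℝ) + 1) ^ ((n : ℝ) + 1 / 2) :=
      Real.one_le_rpow (by linarith [Nat.cast_nonneg (α := ℝ) l]) (by positivity)
    rw [norm_div, norm_pow, norm_neg, Real.norm_eq_abs, Real.norm_eq_abs, abs_of_pos hz0,
      abs_of_pos (zero_lt_one.trans_le hl)]
    exact div_le_self (by positivity) hl
  have hβJ : 0 < β * J := mul_pos hβ hJ
  have hsqrt : √((β * J) ^ (2 * n + 1)) = (β * J) ^ ((n : ℝ) + 1 / 2) := by
    rw [Real.sqrt_eq_rpow, ← Real.rpow_natCast, ← Real.rpow_mul hβJ.le]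
    congr 1
    push_cast
    ring
  have h1 := hs.hasSum.mul_left (((2 * n - 1).doubleFactorial : ℝ) ^ 2
      / ((n.factorial : ℝ) * 8 ^ n * √(2 * Real.pi * (β * J) ^ (2 * n + 1))))
  refine h1.congr_fun fun l => ?_
  rw [besselCoeff, Real.sqrt_mul (by positivity) ((β * J) ^ (2 * n + 1)), hsqrt, Real.rpow_neg (by positivity),
    Real.mul_rpow (by positivity) hβJ.le]
  field_simp

/-- A power series in `-z` without constant term is bounded by a multiple of `z`. -/
theorem abs_le_of_hasSum_alternating {z B s : ℝ} {g : ℕ → ℝ} (hz0 : 0 ≤ z) (hz : z ≤ 1 / 4)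
    (hg : ∀ l, |g l| ≤ B) (hs : HasSum (fun l => (-z) ^ (l + 1) * g l) s) :
    |s| ≤ 4 / 3 * (B * z) := by
  have hz1 : z < 1 := by linarith
  have hB : 0 ≤ B := (abs_nonneg _).trans (hg 0)
  have hgeom := (hasSum_geometric_of_lt_one hz0 hz1).mul_left (B * z)
  have h1 : |s| ≤ B * z * (1 - z)⁻¹ := by
    refine hs.norm_le_of_bounded hgeom fun l => ?_
    rw [norm_mul, norm_pow, norm_neg, Real.norm_eq_abs, Real.norm_eq_abs, abs_of_nonneg hz0,
      pow_succ]
    calc z ^ l * z * |g l| ≤ z ^ l * z * B := by gcongr; exact hg l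
      _ = B * z * z ^ l := by ring
  have h2 : (1 - z)⁻¹ ≤ 4 / 3 := by
    rw [inv_le_comm₀ (by linarith) (by norm_num)]
    linarith
  calc |s| ≤ B * z * (1 - z)⁻¹ := h1
    _ ≤ B * z * (4 / 3) := by gcongr
    _ = _ := mul_comm _ _

/-- If the first coefficient is the largest one, the first term of the series dominates. -/
theorem le_abs_of_hasSum_alternating {z s : ℝ} {g : ℕ → ℝ} (hz0 : 0 ≤ z) (hz : z ≤ 1 / 4)
    (hg : ∀ l, |g l| ≤ g 0) (hs : HasSum (fun l => (-z) ^ (l + 1) * g l) s) :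
    g 0 * z ≤ 3 / 2 * |s| := by
  have hg0 : 0 ≤ g 0 := (abs_nonneg _).trans (hg 0)
  -- without its first term `-z * g 0` the series is of the same kind, with a factor `z` to spare
  have h1 : HasSum (fun l => (-z) ^ (l + 1) * (g (l + 1) * z)) (-(s + z * g 0)) := by
    have h := ((hasSum_nat_add_iff' 1).2 hs).neg
    simp only [Finset.range_one, Finset.sum_singleton, zero_add, pow_one, neg_mul,
      sub_neg_eq_add] at h
    refine h.congr_fun fun l => ?_
    ring
  have h2 := abs_le_of_hasSum_alternating (B := g 0 * z) hz0 hz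
    (fun l => by rw [abs_mul, abs_of_nonneg hz0]; gcongr; exact hg _) h1
  rw [abs_neg] at h2
  have h3 : z * g 0 ≤ |s + z * g 0| + |s| := by
    have := abs_sub (s + z * g 0) s
    rw [add_sub_cancel_left, abs_of_nonneg (by positivity)] at this
    exact this
  nlinarith [mul_nonneg (mul_nonneg hg0 hz0) (sub_nonneg.2 hz)]

/-- The exact order of magnitude of the `n`-th term of the expansion. -/
def expansionScale (J h : ℝ) (n : ℕ) (β : ℝ) : ℝ :=
  (β * J) ^ (-((n : ℝ) + 1 / 2)) * Real.exp (-(β * (h - J)))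

theorem expansionScale_pos (hJ : 0 < J) (n : ℕ) (hβ : 0 < β) : 0 < expansionScale J h n β := by
  have := mul_pos hβ hJ
  unfold expansionScale
  positivity

theorem eventually_exp_gap_le (hh : J < h) :
    ∀ᶠ β in atTop, 0 < β ∧ Real.exp (-(β * (h - J))) ≤ 1 / 4 := by
  have h1 : Tendsto (fun β : ℝ => Real.exp (-(β * (h - J)))) atTop (𝓝 0) :=
    Real.tendsto_exp_neg_atTop_nhds_zero.comp (tendsto_id.atTop_mul_const (sub_pos.2 hh))
  exact (eventually_gt_atTop 0).and (h1.eventually_le_const (by norm_num))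

theorem rpow_neg_succ_mul_le {x p : ℝ} (hx : 0 < x) (hp : 0 ≤ p) (l : ℕ) :
    ((l + 1) * x) ^ (-p) ≤ x ^ (-p) :=
  Real.rpow_le_rpow_of_nonpos hx
    (le_mul_of_one_le_left hx.le (by linarith [Nat.cast_nonneg (α := ℝ) l])) (neg_nonpos.2 hp)

theorem expansionTerm_isBigO (hJ : 0 < J) (hh : J < h) (n : ℕ) :
    expansionTerm J h n =O[atTop] expansionScale J h n := by
  refine IsBigO.of_bound (4 / 3 * besselCoeff n) ?_
  filter_upwards [eventually_exp_gap_le hh] with β ⟨hβ, hz⟩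
  have hβJ := mul_pos hβ hJ
  have hc := besselCoeff_pos n
  have h1 := abs_le_of_hasSum_alternating (B := besselCoeff n * (β * J) ^ (-((n : ℝ) + 1 / 2)))
    (Real.exp_pos _).le hz (fun l => by
      rw [abs_of_nonneg (by positivity)]
      exact mul_le_mul_of_nonneg_left (rpow_neg_succ_mul_le hβJ (by positivity) l) hc.le) (hasSum_expansionTerm hJ hh hβ n)
  rw [Real.norm_eq_abs, Real.norm_eq_abs, abs_of_pos (expansionScale_pos hJ n hβ), expansionScale]
  linarith

theorem expansionScale_isBigO (hJ : 0 < J) (hh : J < h) (n : ℕ) :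
    expansionScale J h n =O[atTop] expansionTerm J h n := by
  refine IsBigO.of_bound (3 / 2 / besselCoeff n) ?_
  filter_upwards [eventually_exp_gap_le hh] with β ⟨hβ, hz⟩
  have hβJ := mul_pos hβ hJ
  have hc := besselCoeff_pos n
  have h1 := le_abs_of_hasSum_alternating
    (g := fun l : ℕ => besselCoeff n * ((l + 1) * (β * J)) ^ (-((n : ℝ) + 1 / 2)))
    (Real.exp_pos _).le hz (fun l => by
      rw [abs_of_nonneg (by positivity)]
      simp only [Nat.cast_zero, zero_add, one_mul]
      exact mul_le_mul_of_nonneg_left (rpow_neg_succ_mul_le hβJ (by positivity) l) hc.le) (hasSum_expansionTerm hJ hh hβ n)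
  simp only [Nat.cast_zero, zero_add, one_mul] at h1
  rw [Real.norm_eq_abs, Real.norm_eq_abs, abs_of_pos (expansionScale_pos hJ n hβ), expansionScale,
    div_mul_eq_mul_div, le_div_iff₀ hc]
  linarith

theorem expansionScale_succ_isLittleO (hJ : 0 < J) (n : ℕ) :
    expansionScale J h (n + 1) =o[atTop] expansionScale J h n := by
  have h1 : Tendsto (fun β : ℝ => (β * J)⁻¹) atTop (𝓝 0) :=
    tendsto_inv_atTop_zero.comp (tendsto_id.atTop_mul_const hJ)
  refine (isLittleO_iff_exists_eq_mul).2 ⟨_, h1, ?_⟩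
  filter_upwards [eventually_gt_atTop 0] with β hβ
  have hβJ := mul_pos hβ hJ
  simp only [Pi.mul_apply, expansionScale]
  rw [← mul_assoc, ← Real.rpow_neg_one, ← Real.rpow_add hβJ]
  congr 2
  push_cast
  ring

/-- Summing the uniform remainder bound of `scaledBessel` over the geometric series. -/
theorem remainder_isBigO (hJ : 0 < J) (hh : J < h) (m : ℕ) :
    (fun β => -downDensity J h β - ∑ n ∈ Finset.range (m + 1), expansionTerm J h n β)
      =O[atTop] expansionScale J h (m + 1) := by
  obtain ⟨C, hC, hbound⟩ := exists_abs_scaledBessel_sub_le m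
  refine IsBigO.of_bound (4 / 3 * C) ?_
  filter_upwards [eventually_exp_gap_le hh] with β ⟨hβ, hz⟩
  have hβJ := mul_pos hβ hJ
  have hs := (hasSum_downDensity hJ hh hβ).sub
    (hasSum_sum fun n (_ : n ∈ Finset.range (m + 1)) => hasSum_expansionTerm hJ hh hβ n)
  simp only [← Finset.mul_sum, ← mul_sub] at hs
  have h1 := abs_le_of_hasSum_alternating
    (B := C * (β * J) ^ (-(((m + 1 : ℕ) : ℝ) + 1 / 2))) (Real.exp_pos _).le hz
    (fun l => (hbound _ (by positivity)).trans
      (mul_le_mul_of_nonneg_left (rpow_neg_succ_mul_le hβJ (by positivity) l) hC)) hs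
  rw [Real.norm_eq_abs, Real.norm_eq_abs, abs_of_pos (expansionScale_pos hJ _ hβ), expansionScale]
  linarith

theorem magnetization_eq (hJ : 0 < J) (hh : J < h) (hβ : 0 < β) :
    magnetization J h β = 1 / 2 - downDensity J h β :=
  (tendsto_finiteMagnetization hJ hh hβ).limUnder_eq

theorem hasAsymptoticExpansion_magnetization (hJ : 0 < J) (hh : J < h) :
    HasAsymptoticExpansion atTop (fun β => magnetization J h β - 1 / 2) (expansionTerm J h) := by
  refine ⟨fun n => ?_, fun m => ?_⟩
  · exact ((expansionTerm_isBigO hJ hh (n + 1)).trans_isLittleO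
      (expansionScale_succ_isLittleO hJ n)).trans_isBigO (expansionScale_isBigO hJ hh n)
  · have h1 := ((remainder_isBigO hJ hh m).trans_isLittleO
      (expansionScale_succ_isLittleO hJ m)).trans_isBigO (expansionScale_isBigO hJ hh m)
    refine h1.congr' ?_ EventuallyEq.rfl
    filter_upwards [eventually_gt_atTop 0] with β hβ
    rw [magnetization_eq hJ hh hβ]
    ring

theorem HasAsymptoticExpansion.comp {l l' : Filter ℝ} {f : ℝ → ℝ} {a b : ℕ → ℝ → ℝ} {k : ℝ → ℝ}
    (H : HasAsymptoticExpansion l f a) (hk : Tendsto k l' l)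
    (hab : ∀ n, (fun x => a n (k x)) =ᶠ[l'] b n) :
    HasAsymptoticExpansion l' (fun x => f (k x)) b := by
  refine ⟨fun n => ((H.1 n).comp_tendsto hk).congr' (hab (n + 1)) (hab n), fun N => ?_⟩
  refine ((H.2 N).comp_tendsto hk).congr' ?_ (hab N)
  have h1 : ∀ᶠ x in l', ∀ n ∈ Finset.range (N + 1), a n (k x) = b n x :=
    (Finset.eventually_all _).2 fun n _ => hab n
  filter_upwards [h1] with x hx
  simp only [Function.comp_apply, Finset.sum_congr rfl hx]

theorem expansionTerm_inv_temperature (hJ : 0 < J) {kB T : ℝ} (hk : 0 < kB) (hT : 0 < T)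
    (n : ℕ) : expansionTerm J h n (1 / (kB * T))
      = -(temperatureCoeff kB J h n T * T ^ ((2 * (n : ℝ) + 1) / 2)) := by
  have hpow : T ^ ((2 * (n : ℝ) + 1) / 2) = √(T ^ (2 * n + 1)) := by
    rw [Real.sqrt_eq_rpow, ← Real.rpow_natCast, ← Real.rpow_mul hT.le]
    congr 1
    push_cast
    ring
  have hs : (n : ℝ) + 1 / 2 = (2 * (n : ℝ) + 1) / 2 := by ring
  have hx : 1 / (kB * T) * (h - J) = (h - J) / (kB * T) := by ring
  have hsq : √(2 * Real.pi * (1 / (kB * T) * J) ^ (2 * n + 1))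
      = √(2 * Real.pi * J ^ (2 * n + 1)) / (√(kB ^ (2 * n + 1)) * √(T ^ (2 * n + 1))) := by
    rw [← Real.sqrt_mul (by positivity), ← mul_pow, ← Real.sqrt_div (by positivity)]
    congr 1
    rw [mul_pow, div_pow, one_pow]
    ring
  have h1 : 0 < √(kB ^ (2 * n + 1)) := Real.sqrt_pos.2 (by positivity)
  have h2 : 0 < √(T ^ (2 * n + 1)) := Real.sqrt_pos.2 (by positivity)
  have h3 : 0 < √(2 * Real.pi * J ^ (2 * n + 1)) := Real.sqrt_pos.2 (by positivity)
  rw [expansionTerm, temperatureCoeff, hpow, hs, hx, hsq]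
  field_simp

end Expansion

end SpinChain

end

theorem proposition2 (J h : ℝ) (hJ : 0 < J) (hh : J < h) :
    -- the infinite-chain magnetization exists as a limit of the finite-chain ones
    (∀ β : ℝ, 0 < β →
      Tendsto (SpinChain.finiteMagnetization J h β) atTop
        (𝓝 (SpinChain.magnetization J h β))) ∧
    -- the expansion as `β → ∞`
    SpinChain.HasAsymptoticExpansion atTop
      (fun β => SpinChain.magnetization J h β - 1 / 2)
      (SpinChain.expansionTerm J h) ∧
    -- the same in terms of the temperature `T = 1 / (k_B β)`, as `T → 0+`
    (∀ kB : ℝ, 0 < kB →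
      SpinChain.HasAsymptoticExpansion (𝓝[>] 0)
        (fun T => SpinChain.magnetization J h (1 / (kB * T)) - 1 / 2)
        (fun n T =>
          -(SpinChain.temperatureCoeff kB J h n T * T ^ ((2 * (n : ℝ) + 1) / 2)))) := by
  have hexp := SpinChain.hasAsymptoticExpansion_magnetization hJ hh
  refine ⟨fun β hβ => ?_, hexp, fun kB hk => ?_⟩
  · rw [SpinChain.magnetization_eq hJ hh hβ]
    exact SpinChain.tendsto_finiteMagnetization hJ hh hβ
  · refine hexp.comp (k := fun T => 1 / (kB * T)) ?_ fun n => ?_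
    · simp only [one_div, mul_inv]
      exact tendsto_inv_nhdsGT_zero.const_mul_atTop (inv_pos.2 hk)
    · filter_upwards [self_mem_nhdsWithin] with T hT
      exact SpinChain.expansionTerm_inv_temperature hJ hk hT n
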